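/- Let $q\ge 2$ be an integer and let $X$ be a $q$-homogeneous tree, i.e. a tree in which every vertex has exactly $q+1$ neighbours. Fix a vertex $o\in X$ and put $|x|=d(o,x)$, where $d$ is the graph distance. For $\alpha>1$ let $\mu_\alpha$ be the measure on $X$ with density $q^{-\alpha|x|}$ with respect to the counting measure. For $1\le p<\infty$ let $L^p_\alpha=L^p(X,\mu_\alpha)$ (complex-valued functions), and let $\mathcal A^p_\alpha$ be the subspace of those $f\in L^p_\alpha$ that are harmonic, i.e. $f(v)=\frac1{q+1}\sum_{u\sim v}f(u)$ for all $v\in X$. The space $\mathcal A^2_\alpha$ is closed in $L^2_\alpha$ and is a reproducing kernel Hilbert space; let $K_\alpha(z,x)=K_{\alpha,z}(x)$ be its kernel, where $K_{\alpha,z}\in\mathcal A^2_\alpha$ and $\langle g,K_{\alpha,z}\rangle_{L^2_\alpha}=g(z)$ for all $g\in\mathcal A^2_\alpha$ and $z\in X$, and let $P_\alpha\colon L^2_\alpha\to\mathcal A^2_\alpha$ be the orthogonal projection (the Bergman projector). **Theorem.** Let $1\le p<\infty$ and $\alpha,\beta>1$. The operator $$\mathcal K^\alpha_\beta f(z)=\sum_{x\in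 X}K_\beta(z,x)\,f(x)\,q^{(\alpha-\beta)|x|}\,q^{-\alpha|x|},\qquad f\in L^p_\alpha\cap L^2_\beta,\ z\in X,$$ extends to a bounded linear operator from $L^p_\alpha$ to $\mathcal A^p_\alpha$ if and only if $$p(\beta-1)>\alpha-1.$$ In particular, $P_\alpha$ is bounded on $L^p_\alpha$ (that is, the restriction of $P_\alpha$ to $L^p_\alpha\cap L^2_\alpha$ extends to a bounded linear operator on $L^p_\alpha$) if and only if $p>1$. -/

import Mathlib

open MeasureTheory
open scoped ENNReal

namespace HarmonicBergman

/-- `G` is a `q`-homogeneous tree with `q ≥ 2`: a tree in which every vertex has exactly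
`q + 1` neighbours. -/
class IsHomogeneousTree {V : Type*} (G : SimpleGraph V) [G.LocallyFinite] (q : ℕ) : Prop where
  two_le : 2 ≤ q
  isTree : G.IsTree
  isRegular : G.IsRegularOfDegree (q + 1)

/-- The exponentially decreasing radial measure `μ_α`, whose density with respect to the counting
measure is `x ↦ q ^ (-α |x|)`, where `|x| = d(o, x)`. -/
noncomputable def mu {V : Type*} [MeasurableSpace V] (G : SimpleGraph V) (q : ℕ) (o : V) (α : ℝ) :
    Measure V :=
  Measure.count.withDensity fun x => ENNReal.ofReal ((q : ℝ) ^ (-α * (G.dist o x : ℝ)))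

/-- A complex-valued function is harmonic if its value at every vertex is the mean of its values
at the `q + 1` neighbours. -/
def IsHarmonic {V : Type*} (G : SimpleGraph V) [G.LocallyFinite] (q : ℕ) (f : V → ℂ) : Prop :=
  ∀ v, f v = 1 / ((q : ℂ) + 1) * ∑ u ∈ G.neighborFinset v, f u

theorem mu_singleton {V : Type*} [MeasurableSpace V] [DiscreteMeasurableSpace V]
    (G : SimpleGraph V) (q : ℕ) (o : V) (α : ℝ) (x : V) :
    mu G q o α {x} = ENNReal.ofReal ((q : ℝ) ^ (-α * (G.dist o x : ℝ))) := by
  rw [mu, withDensity_apply _ (measurableSet_singleton x), lintegral_singleton,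
    Measure.count_singleton, mul_one]

theorem mu_singleton_ne_top {V : Type*} [MeasurableSpace V] [DiscreteMeasurableSpace V]
    (G : SimpleGraph V) (q : ℕ) (o : V) (α : ℝ) (x : V) : mu G q o α {x} ≠ ∞ := by
  rw [mu_singleton]; exact ENNReal.ofReal_ne_top

theorem mu_singleton_ne_zero {V : Type*} [MeasurableSpace V] [DiscreteMeasurableSpace V]
    (G : SimpleGraph V) [G.LocallyFinite] (q : ℕ) [hG : IsHomogeneousTree G q] (o : V) (α : ℝ)
    (x : V) : mu G q o α {x} ≠ 0 := by
  have h2 := hG.two_le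
  have hq : (0 : ℝ) < q := by exact_mod_cast (by omega : 0 < q)
  rw [mu_singleton]
  exact (ENNReal.ofReal_pos.2 (Real.rpow_pos_of_pos hq _)).ne'

/-- Since every vertex has positive mass, functions that agree almost everywhere are equal. -/
theorem eq_of_ae_eq {V : Type*} [MeasurableSpace V] [DiscreteMeasurableSpace V]
    (G : SimpleGraph V) [G.LocallyFinite] (q : ℕ) [IsHomogeneousTree G q] (o : V) (α : ℝ)
    {f g : V → ℂ} (h : f =ᵐ[mu G q o α] g) : f = g := by
  funext x
  by_contra hx
  apply mu_singleton_ne_zero G q o α x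
  exact measure_mono_null (by simpa using hx) (ae_iff.1 h)

/-- The harmonic Bergman space `𝒜^p_α`: the harmonic functions in `L^p_α = L^p(μ_α)`. -/
def bergman {V : Type*} [MeasurableSpace V] [DiscreteMeasurableSpace V]
    (G : SimpleGraph V) [G.LocallyFinite] (q : ℕ) [IsHomogeneousTree G q] (o : V)
    (p : ℝ≥0∞) (α : ℝ) : Submodule ℂ (Lp ℂ p (mu G q o α)) where
  carrier := {f | IsHarmonic G q f}
  zero_mem' := by
    intro v
    rw [eq_of_ae_eq G q o α (Lp.coeFn_zero ℂ p (mu G q o α))]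
    simp
  add_mem' := by
    intro f g hf hg v
    rw [eq_of_ae_eq G q o α (Lp.coeFn_add f g)]
    simp only [Pi.add_apply, Finset.sum_add_distrib, mul_add]
    rw [← hf v, ← hg v]
  smul_mem' := by
    intro c f hf v
    rw [eq_of_ae_eq G q o α (Lp.coeFn_smul c f)]
    simp only [Pi.smul_apply, smul_eq_mul, ← Finset.mul_sum]
    rw [mul_left_comm, ← hf v]

theorem continuous_eval {V : Type*} [MeasurableSpace V] [DiscreteMeasurableSpace V]
    (G : SimpleGraph V) [G.LocallyFinite] (q : ℕ) [IsHomogeneousTree G q] (o : V) (α : ℝ) (x : V) :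
    Continuous fun f : Lp ℂ 2 (mu G q o α) => f x := by
  have h : (fun f : Lp ℂ 2 (mu G q o α) => f x) = fun f =>
      (((mu G q o α).real {x} : ℝ) : ℂ)⁻¹ * inner ℂ (indicatorConstLp 2
        (measurableSet_singleton x) (mu_singleton_ne_top G q o α x) (1 : ℂ)) f := by
    funext f
    have hne : (((mu G q o α).real {x} : ℝ) : ℂ) ≠ 0 := by
      rw [Complex.ofReal_ne_zero]
      exact (ENNReal.toReal_pos (mu_singleton_ne_zero G q o α x)
        (mu_singleton_ne_top G q o α x)).ne'
    rw [L2.inner_indicatorConstLp_one, integral_singleton, Complex.real_smul,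
      inv_mul_cancel_left₀ hne]
  rw [h]
  fun_prop

theorem isClosed_bergman {V : Type*} [MeasurableSpace V] [DiscreteMeasurableSpace V]
    (G : SimpleGraph V) [G.LocallyFinite] (q : ℕ) [IsHomogeneousTree G q] (o : V) (α : ℝ) :
    IsClosed (bergman G q o 2 α : Set (Lp ℂ 2 (mu G q o α))) := by
  have h : (bergman G q o 2 α : Set (Lp ℂ 2 (mu G q o α))) =
      ⋂ v, {f | f v = 1 / ((q : ℂ) + 1) * ∑ u ∈ G.neighborFinset v, f u} := by
    ext f
    simp [bergman, IsHarmonic]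
  rw [h]
  refine isClosed_iInter fun v => isClosed_eq (continuous_eval G q o α v) ?_
  exact continuous_const.mul (continuous_finsetSum _ fun u _ => continuous_eval G q o α u)

instance completeSpace_bergman {V : Type*} [MeasurableSpace V] [DiscreteMeasurableSpace V]
    (G : SimpleGraph V) [G.LocallyFinite] (q : ℕ) [IsHomogeneousTree G q] (o : V) (α : ℝ) :
    CompleteSpace (bergman G q o 2 α) :=
  (isClosed_bergman G q o α).completeSpace_coe

/-- `𝒜^2_α` is a reproducing kernel Hilbert space of functions on the vertices. -/
noncomputable instance rkhs_bergman {V : Type*} [MeasurableSpace V] [DiscreteMeasurableSpace V]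
    (G : SimpleGraph V) [G.LocallyFinite] (q : ℕ) [IsHomogeneousTree G q] (o : V) (α : ℝ) :
    RKHS ℂ (bergman G q o 2 α) V ℂ where
  coeCLM :=
    { toFun := fun f => ((f : Lp ℂ 2 (mu G q o α)) : V → ℂ)
      map_add' := fun _ _ => eq_of_ae_eq G q o α (Lp.coeFn_add _ _)
      map_smul' := fun c f => eq_of_ae_eq G q o α (Lp.coeFn_smul c f.1)
      cont := continuous_pi fun x => (continuous_eval G q o α x).comp continuous_subtype_val }
  coeCLM_injective := fun _ _ h => Subtype.ext (Lp.ext (Filter.EventuallyEq.of_eq h))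

/-- The reproducing kernel `K_β(z, x) = K_{β,z}(x)` of `𝒜^2_β`, where `K_{β,z} ∈ 𝒜^2_β` is
the function with `⟨g, K_{β,z}⟩ = g(z)` for all `g ∈ 𝒜^2_β`. -/
noncomputable def kernel {V : Type*} [MeasurableSpace V] [DiscreteMeasurableSpace V]
    (G : SimpleGraph V) [G.LocallyFinite] (q : ℕ) [IsHomogeneousTree G q] (o : V) (β : ℝ)
    (z x : V) : ℂ :=
  ((RKHS.kerFun (bergman G q o 2 β) z 1 : bergman G q o 2 β) : Lp ℂ 2 (mu G q o β)) x

/-- The operator `𝒦_β^α` with kernel `K_β(z, x) q ^ ((α - β) |x|)` with respect to `μ_α`. -/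
noncomputable def kernelOperator {V : Type*} [MeasurableSpace V] [DiscreteMeasurableSpace V]
    (G : SimpleGraph V) [G.LocallyFinite] (q : ℕ) [IsHomogeneousTree G q] (o : V) (α β : ℝ)
    (f : V → ℂ) (z : V) : ℂ :=
  ∑' x, kernel G q o β z x * f x * (((q : ℝ) ^ ((α - β) * (G.dist o x : ℝ)) : ℝ) : ℂ) *
    (((q : ℝ) ^ (-α * (G.dist o x : ℝ)) : ℝ) : ℂ)

/-- The Bergman projector `P_α`: the orthogonal projection of `L^2_α` onto `𝒜^2_α`. -/
noncomputable def projector {V : Type*} [MeasurableSpace V] [DiscreteMeasurableSpace V]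
    (G : SimpleGraph V) [G.LocallyFinite] (q : ℕ) [IsHomogeneousTree G q] (o : V) (α : ℝ) :
    Lp ℂ 2 (mu G q o α) →L[ℂ] bergman G q o 2 α :=
  (bergman G q o 2 α).orthogonalProjectionOnto

end HarmonicBergman

namespace HarmonicBergman

/-! The kernel can be computed. Put r = q^(-β) and let p denote the parent map. For y ≠ o,
`sectorWave` takes the value 1 + q⁻¹ + ⋯ + q^(-k) on the k-th generation below y, vanishes off the
sector of y, and fails to be harmonic only at p(y). All siblings share this defect, so subtracting
the mean over the siblings gives a bounded function `sectorHarmonic` that is harmonic everywhere and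
lives in the sector of p(y).

Pairing a harmonic g with it, with density r^|x|, gives r^|p(y)| B times the deviation of g(y) from
the mean of g over the siblings, with B = `profileNormSq`. Conversely, these deviations along the
path from z to the root, weighted by the same geometric partial sums, telescope to g(z) - g(o).
Together with the mean value property at the root this yields the reproducing formula
`tsum_explicitKernel_mul`, hence `kernel_eq`.

Sufficiency: the kernel is dominated by the sum of q^(β|v|) over the common ancestors v of z and x
(`exists_abs_explicitKernel_le`). This positive kernel is handled by a Schur test with weight
q^(τ|x|) (`exists_schur_bound`), and an admissible τ exists when p(β - 1) > α - 1
(`exists_schur_exponent`).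

Necessity for p > 1: at the root the kernel is constant, so testing on q^((α-1)|x|/p) truncated to
|x| < N compares N^p with N when the inequality fails. For p = 1 a point mass at x with |x| = n is
used: on each sphere of radius 1, …, n the kernel cannot be small both at the ancestor of x and at a
sibling of it, so if α ≥ β the norm ratio grows like n.

The statement on the projector is the case β = α, because P_α is the integral operator with kernel
K_α (`projector_eq_kernelOperator`). -/

section Rooted

variable {V : Type*} {G : SimpleGraph V} {o : V}

/-! ### Geometry of the rooted tree: parents, sectors, generations. -/

open Classical in
/-- The neighbour of `x` that is closer to the root `o`; the root is its own parent. -/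
noncomputable def parent (G : SimpleGraph V) (o x : V) : V :=
  if h : ∃ u, G.Adj x u ∧ G.dist o u + 1 = G.dist o x then h.choose else x

theorem parent_root : parent G o o = o := by
  simp [parent]

theorem exists_closer_neighbor (hG : G.IsTree) {x : V} (hx : x ≠ o) :
    ∃ u, G.Adj x u ∧ G.dist o u + 1 = G.dist o x := by
  obtain ⟨p, hp⟩ := hG.connected.exists_walk_length_eq_dist x o
  cases p with
  | nil => exact absurd rfl hx
  | @cons _ u _ h p =>
    refine ⟨u, h, ?_⟩
    have h1 := SimpleGraph.dist_le p
    have h2 := hG.dist_eq_dist_add_one_of_adj o h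
    rw [SimpleGraph.Walk.length_cons, SimpleGraph.dist_comm] at hp
    rw [SimpleGraph.dist_comm] at h1
    omega

theorem adj_parent (hG : G.IsTree) {x : V} (hx : x ≠ o) : G.Adj x (parent G o x) := by
  have h := exists_closer_neighbor hG hx
  rw [parent, dif_pos h]
  exact h.choose_spec.1

theorem dist_parent_add_one (hG : G.IsTree) {x : V} (hx : x ≠ o) :
    G.dist o (parent G o x) + 1 = G.dist o x := by
  have h := exists_closer_neighbor hG hx
  rw [parent, dif_pos h]
  exact h.choose_spec.2

theorem dist_parent (hG : G.IsTree) (x : V) :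
    G.dist o (parent G o x) = G.dist o x - 1 := by
  by_cases hx : x = o
  · subst hx; simp [parent_root]
  · have := dist_parent_add_one hG hx; omega

theorem dist_iterate_parent (hG : G.IsTree) (k : ℕ) (x : V) :
    G.dist o ((parent G o)^[k] x) = G.dist o x - k := by
  induction k with
  | zero => rfl
  | succ k ih => rw [Function.iterate_succ_apply', dist_parent hG, ih]; omega

theorem dist_pos (hG : G.IsTree) {x : V} : 0 < G.dist o x ↔ x ≠ o := by
  rw [Nat.pos_iff_ne_zero, ne_eq, hG.connected.dist_eq_zero_iff, eq_comm]

/-- Geodesics from the root to u and v extend by one edge to geodesics ending at x. Paths in a tree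
are unique, so these coincide and have the same penultimate vertex. -/
theorem closer_neighbor_unique (hG : G.IsTree) {x u v : V} (hu : G.Adj x u) (hv : G.Adj x v)
    (hdu : G.dist o u + 1 = G.dist o x) (hdv : G.dist o v + 1 = G.dist o x) : u = v := by
  obtain ⟨p, hp⟩ := hG.connected.exists_walk_length_eq_dist o u
  obtain ⟨r, hr⟩ := hG.connected.exists_walk_length_eq_dist o v
  have h1 : (p.concat hu.symm).IsPath := SimpleGraph.Walk.isPath_of_length_eq_dist _
    (by rw [SimpleGraph.Walk.length_concat]; omega)
  have h2 : (r.concat hv.symm).IsPath := SimpleGraph.Walk.isPath_of_length_eq_dist _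
    (by rw [SimpleGraph.Walk.length_concat]; omega)
  have h := (hG.2.subsingleton_path o x).elim ⟨_, h1⟩ ⟨_, h2⟩
  have h' : p.concat hu.symm = r.concat hv.symm := congrArg Subtype.val h
  have := congrArg SimpleGraph.Walk.penultimate h'
  simpa using this

theorem adj_iff_parent (hG : G.IsTree) {x u : V} :
    G.Adj x u ↔ (x ≠ o ∧ u = parent G o x) ∨ (u ≠ o ∧ parent G o u = x) := by
  constructor
  · intro h
    have hlt : ∀ {x u : V}, G.Adj x u → G.dist o x = G.dist o u + 1 →
        x ≠ o ∧ u = parent G o x := by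
      intro x u h hd
      have hx : x ≠ o := (dist_pos hG).1 (by omega)
      exact ⟨hx, closer_neighbor_unique hG h (adj_parent hG hx) hd.symm
        (dist_parent_add_one hG hx)⟩
    rcases hG.dist_eq_dist_add_one_of_adj o h with h1 | h1
    · exact Or.inl (hlt h h1)
    · obtain ⟨h2, h3⟩ := hlt h.symm h1
      exact Or.inr ⟨h2, h3.symm⟩
  · rintro (⟨h, rfl⟩ | ⟨h, rfl⟩)
    · exact adj_parent hG h
    · exact (adj_parent hG h).symm

/-- The vertices `x` such that `y` lies on the geodesic from the root `o` to `x`. -/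
def sector (G : SimpleGraph V) (o y : V) : Set V :=
  {x | (parent G o)^[G.dist o x - G.dist o y] x = y}

theorem mem_sector_iff {x y : V} :
    x ∈ sector G o y ↔ (parent G o)^[G.dist o x - G.dist o y] x = y := Iff.rfl

theorem dist_le_of_mem_sector {x y : V} (h : x ∈ sector G o y) :
    G.dist o y ≤ G.dist o x := by
  by_contra! hlt
  -- If x were closer to the root than y, truncated subtraction would make the iterate trivial and
  -- force x = y.
  rw [mem_sector_iff, Nat.sub_eq_zero_of_le hlt.le] at h
  exact hlt.ne (congrArg (G.dist o) h)

theorem self_mem_sector (y : V) : y ∈ sector G o y := by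
  simp [mem_sector_iff]

theorem mem_sector_iterate (hG : G.IsTree) (x : V) {k : ℕ} (hk : k ≤ G.dist o x) :
    x ∈ sector G o ((parent G o)^[k] x) := by
  rw [mem_sector_iff, dist_iterate_parent hG, Nat.sub_sub_self hk]

theorem iterate_parent_dist (hG : G.IsTree) (x : V) : (parent G o)^[G.dist o x] x = o := by
  have h := dist_iterate_parent (o := o) hG (G.dist o x) x
  rw [Nat.sub_self, hG.connected.dist_eq_zero_iff] at h
  exact h.symm

theorem sector_root (hG : G.IsTree) : sector G o o = Set.univ := by
  ext x
  simp [mem_sector_iff, iterate_parent_dist hG]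

theorem mem_sector_parent (hG : G.IsTree) {x y : V} (h : x ∈ sector G o y) :
    x ∈ sector G o (parent G o y) := by
  have hle := dist_le_of_mem_sector h
  by_cases hy : y = o
  · subst hy; rwa [parent_root]
  · have := dist_parent_add_one hG hy
    rw [mem_sector_iff] at h
    rw [mem_sector_iff, show G.dist o x - G.dist o (parent G o y) =
      (G.dist o x - G.dist o y) + 1 by omega, Function.iterate_succ_apply', h]

/-- A sector is left upwards only through its top vertex. Later this shows that a sector with top
different from two siblings contains both or neither. -/
theorem parent_mem_sector_iff (hG : G.IsTree) {x y : V} (hxy : x ≠ y) :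
    parent G o x ∈ sector G o y ↔ x ∈ sector G o y := by
  have hd := dist_parent (o := o) hG x
  by_cases hx : x = o
  · subst hx; rw [parent_root]
  have hx' := (dist_pos hG).2 hx
  constructor
  · intro h
    have := dist_le_of_mem_sector h
    rw [mem_sector_iff] at h ⊢
    rwa [show G.dist o x - G.dist o y = (G.dist o (parent G o x) - G.dist o y) + 1 by omega,
      Function.iterate_succ_apply]
  · intro h
    have := dist_le_of_mem_sector h
    rw [mem_sector_iff] at h ⊢
    rcases this.eq_or_lt with he | hlt
    · rw [he, Nat.sub_self] at h; exact absurd h hxy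
    · rwa [show G.dist o x - G.dist o y = (G.dist o (parent G o x) - G.dist o y) + 1 by omega,
        Function.iterate_succ_apply] at h

/-- The ancestors of z are its iterated parents, which are distinct because their distances to the
root differ. -/
theorem tsum_ancestors (hG : G.IsTree) (z : V) (f : V → ℝ≥0∞) :
    ∑' v, {v | z ∈ sector G o v}.indicator f v =
      ∑ i ∈ Finset.range (G.dist o z + 1), f ((parent G o)^[i] z) := by
  classical
  have hinj : Set.InjOn (fun i => (parent G o)^[i] z) (Finset.range (G.dist o z + 1)) := by
    intro i hi j hj hij
    have h := congrArg (G.dist o) hij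
    simp only [dist_iterate_parent hG] at h
    simp only [Finset.coe_range, Set.mem_Iio] at hi hj
    omega
  rw [← Finset.sum_image (f := f) hinj, tsum_eq_sum (s := (Finset.range (G.dist o z + 1)).image
    fun i => (parent G o)^[i] z)]
  · refine Finset.sum_congr rfl fun v hv => Set.indicator_of_mem ?_ f
    obtain ⟨i, hi, rfl⟩ := Finset.mem_image.1 hv
    exact mem_sector_iterate hG z (by simpa [Nat.lt_succ_iff] using hi)
  · intro v hv
    refine Set.indicator_of_notMem (fun h => hv (Finset.mem_image.2 ⟨G.dist o z - G.dist o v, ?_, h⟩)) f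
    rw [Finset.mem_range]; omega

variable [G.LocallyFinite]

open Classical in
/-- The neighbours of `x` other than its parent. -/
noncomputable def children (G : SimpleGraph V) [G.LocallyFinite] (o x : V) : Finset V :=
  (G.neighborFinset x).filter fun y => y ≠ parent G o x

theorem mem_children (hG : G.IsTree) {x y : V} :
    y ∈ children G o x ↔ y ≠ o ∧ parent G o y = x := by
  classical
  rw [children, Finset.mem_filter, SimpleGraph.mem_neighborFinset, adj_iff_parent (o := o) hG]
  constructor
  · rintro ⟨⟨-, h⟩ | h, h'⟩
    · exact absurd h h'
    · exact h
  · intro h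
    refine ⟨Or.inr h, fun h' => ?_⟩
    have h1 := dist_parent_add_one hG h.1
    have h2 := dist_parent (o := o) hG x
    rw [← h', h.2.symm] at h2
    omega

theorem dist_of_mem_children (hG : G.IsTree) {x y : V} (h : y ∈ children G o x) :
    G.dist o y = G.dist o x + 1 := by
  obtain ⟨h1, rfl⟩ := (mem_children hG).1 h
  exact (dist_parent_add_one hG h1).symm

theorem sum_neighborFinset {M : Type*} [AddCommMonoid M] (hG : G.IsTree) {x : V} (hx : x ≠ o)
    (f : V → M) :
    ∑ u ∈ G.neighborFinset x, f u = f (parent G o x) + ∑ y ∈ children G o x, f y := by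
  classical
  have h : G.neighborFinset x = insert (parent G o x) (children G o x) := by
    ext u
    rw [Finset.mem_insert, mem_children hG, SimpleGraph.mem_neighborFinset,
      adj_iff_parent (o := o) hG]
    tauto
  have hn : parent G o x ∉ children G o x := by simp [children]
  rw [h, Finset.sum_insert hn]

theorem children_root (hG : G.IsTree) : children G o o = G.neighborFinset o := by
  ext u
  rw [mem_children hG, SimpleGraph.mem_neighborFinset, adj_iff_parent (o := o) hG]
  tauto

/-- The descendants of `y` that are `k` generations further from the root. -/
noncomputable def descendants (G : SimpleGraph V) [G.LocallyFinite] (o : V) : ℕ → V → Finset V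
  | 0, y => {y}
  | k + 1, y => by
    classical exact (children G o y).biUnion fun y' => descendants G o k y'

theorem mem_descendants_succ {k : ℕ} {x y : V} :
    x ∈ descendants G o (k + 1) y ↔ ∃ y' ∈ children G o y, x ∈ descendants G o k y' := by
  classical
  simp [descendants]

theorem mem_descendants (hG : G.IsTree) {k : ℕ} {x y : V} :
    x ∈ descendants G o k y ↔ G.dist o x = G.dist o y + k ∧ x ∈ sector G o y := by
  have key : x ∈ descendants G o k y ↔ G.dist o x = G.dist o y + k ∧ (parent G o)^[k] x = y := by
    induction k generalizing y with
    | zero =>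
      simp only [descendants, Finset.mem_singleton, add_zero, Function.iterate_zero, id]
      exact ⟨fun h => by simp [h], fun h => h.2⟩
    | succ k ih =>
      rw [mem_descendants_succ]
      constructor
      · rintro ⟨y', hy', h⟩
        rw [ih] at h
        have := dist_of_mem_children hG hy'
        refine ⟨by omega, ?_⟩
        rw [Function.iterate_succ_apply', h.2, ((mem_children hG).1 hy').2]
      · rintro ⟨h1, h2⟩
        have hd := dist_iterate_parent (o := o) hG k x
        rw [Function.iterate_succ_apply'] at h2
        have h0 : (parent G o)^[k] x ≠ o := (dist_pos hG).1 (by omega)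
        exact ⟨(parent G o)^[k] x, (mem_children hG).2 ⟨h0, h2⟩, ih.2 ⟨by omega, rfl⟩⟩
  rw [key]
  refine and_congr_right fun h => ?_
  rw [mem_sector_iff, h, Nat.add_sub_cancel_left]

theorem sum_descendants_succ {M : Type*} [AddCommMonoid M] (hG : G.IsTree) (k : ℕ) (y : V)
    (f : V → M) :
    ∑ x ∈ descendants G o (k + 1) y, f x =
      ∑ y' ∈ children G o y, ∑ x ∈ descendants G o k y', f x := by
  classical
  have : descendants G o (k + 1) y =
      (children G o y).biUnion fun y' => descendants G o k y' := by
    ext x; simp [mem_descendants_succ]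
  rw [this, Finset.sum_biUnion]
  intro u hu v hv huv
  refine Finset.disjoint_left.2 fun x hxu hxv => huv ?_
  have h1 := (mem_descendants hG).1 hxu
  have h2 := (mem_descendants hG).1 hxv
  have h3 := dist_of_mem_children hG hu
  have h4 := dist_of_mem_children hG hv
  rw [← mem_sector_iff.1 h1.2, ← mem_sector_iff.1 h2.2, h3, h4]

/-- A sector is the disjoint union of its generations. -/
noncomputable def sectorEquiv (hG : G.IsTree) (y : V) :
    (Σ k : ℕ, descendants G o k y) ≃ sector G o y where
  toFun s := ⟨s.2, ((mem_descendants hG).1 s.2.2).2⟩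
  invFun x := ⟨G.dist o x.1 - G.dist o y, x.1, (mem_descendants hG).2
    ⟨by have := dist_le_of_mem_sector x.2; omega, x.2⟩⟩
  left_inv := by
    rintro ⟨k, x, hx⟩
    have h := ((mem_descendants hG).1 hx).1
    have h' : G.dist o x - G.dist o y = k := by omega
    subst h'
    rfl
  right_inv _ := rfl

theorem tsum_sector_ennreal (hG : G.IsTree) (y : V) (f : V → ℝ≥0∞) :
    ∑' x, (sector G o y).indicator f x = ∑' k, ∑ x ∈ descendants G o k y, f x := by
  rw [← tsum_subtype, ← (sectorEquiv hG y).tsum_eq, ENNReal.tsum_sigma']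
  exact tsum_congr fun k => Finset.tsum_subtype (descendants G o k y) f

theorem tsum_sector (hG : G.IsTree) (y : V) {f : V → ℂ} (hf : Summable f) :
    ∑' x, (sector G o y).indicator f x = ∑' k, ∑ x ∈ descendants G o k y, f x := by
  rw [← tsum_subtype, ← (sectorEquiv hG y).tsum_eq, Summable.tsum_sigma]
  · exact tsum_congr fun k => Finset.tsum_subtype (descendants G o k y) f
  · exact (sectorEquiv hG y).summable_iff.2 (hf.subtype _)

/-- The whole tree is the sector of the root, a countable union of finite generations. Countability
allows integrals to be written as sums. -/
theorem countable_of_isTree (hG : G.IsTree) : Countable V := by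
  obtain ⟨o⟩ := hG.connected.nonempty
  have h : Countable (sector G o o) := (sectorEquiv (o := o) hG o).countable_iff.1 inferInstance
  rw [sector_root hG] at h
  exact Set.countable_univ_iff.1 h

theorem card_children_of_ne_root {q : ℕ} [hG : IsHomogeneousTree G q] {x : V} (hx : x ≠ o) :
    (children G o x).card = q := by
  have h := sum_neighborFinset hG.isTree hx fun _ => (1 : ℕ)
  rw [← Finset.card_eq_sum_ones, ← Finset.card_eq_sum_ones, G.card_neighborFinset_eq_degree,
    hG.isRegular.degree_eq] at h
  omega

theorem card_children_root {q : ℕ} [hG : IsHomogeneousTree G q] :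
    (children G o o).card = q + 1 := by
  rw [children_root hG.isTree, G.card_neighborFinset_eq_degree, hG.isRegular.degree_eq]

theorem card_descendants_of_ne_root {q : ℕ} [hG : IsHomogeneousTree G q] (k : ℕ) {x : V}
    (hx : x ≠ o) : (descendants G o k x).card = q ^ k := by
  induction k generalizing x with
  | zero => simp [descendants]
  | succ k ih =>
    rw [Finset.card_eq_sum_ones, sum_descendants_succ hG.isTree]
    simp only [← Finset.card_eq_sum_ones]
    rw [Finset.sum_congr rfl fun y hy => ih ((mem_children hG.isTree).1 hy).1, Finset.sum_const,
      card_children_of_ne_root (q := q) hx, smul_eq_mul, pow_succ']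

theorem card_descendants_root_succ {q : ℕ} [hG : IsHomogeneousTree G q] (k : ℕ) :
    (descendants G o (k + 1) o).card = (q + 1) * q ^ k := by
  rw [Finset.card_eq_sum_ones, sum_descendants_succ hG.isTree]
  simp only [← Finset.card_eq_sum_ones]
  rw [Finset.sum_congr rfl fun y hy =>
    card_descendants_of_ne_root (q := q) k ((mem_children hG.isTree).1 hy).1, Finset.sum_const,
    card_children_root (q := q), smul_eq_mul]

/-- The factor 2 only absorbs the extra child of the root. -/
theorem card_descendants_le (q : ℕ) [hG : IsHomogeneousTree G q] (k : ℕ) (x : V) :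
    (descendants G o k x).card ≤ 2 * q ^ k := by
  have hq := hG.two_le
  by_cases hx : x = o
  · subst hx
    cases k with
    | zero => simp [descendants]
    | succ k =>
      rw [card_descendants_root_succ (q := q), pow_succ]
      nlinarith [pow_pos (by omega : 0 < q) k]
  · rw [card_descendants_of_ne_root (q := q) k hx]; omega

theorem le_card_descendants (q : ℕ) [hG : IsHomogeneousTree G q] (k : ℕ) (x : V) :
    q ^ k ≤ (descendants G o k x).card := by
  by_cases hx : x = o
  · subst hx
    cases k with
    | zero => simp [descendants]
    | succ k =>
      rw [card_descendants_root_succ (q := q), pow_succ]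
      nlinarith [Nat.zero_le (q ^ k)]
  · rw [card_descendants_of_ne_root (q := q) k hx]

end Rooted

/-! ### Harmonic functions supported in sectors. -/

/-- The partial sums `1 + q⁻¹ + ⋯ + q^(1-k)` of the geometric series. -/
noncomputable def geomCoef (q : ℕ) : ℕ → ℝ
  | 0 => 0
  | k + 1 => 1 + geomCoef q k / q

theorem geomCoef_zero (q : ℕ) : geomCoef q 0 = 0 := rfl

theorem geomCoef_succ (q k : ℕ) : geomCoef q (k + 1) = 1 + geomCoef q k / q := rfl

theorem geomCoef_one (q : ℕ) : geomCoef q 1 = 1 := by simp [geomCoef]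

theorem geomCoef_nonneg (q k : ℕ) : 0 ≤ geomCoef q k := by
  induction k with
  | zero => exact le_rfl
  | succ k ih => rw [geomCoef_succ]; positivity

theorem one_le_geomCoef_succ (q k : ℕ) : 1 ≤ geomCoef q (k + 1) := by
  rw [geomCoef_succ]
  have := geomCoef_nonneg q k
  linarith [div_nonneg this (Nat.cast_nonneg (α := ℝ) q)]

theorem geomCoef_le_two {q : ℕ} (hq : 2 ≤ q) (k : ℕ) : geomCoef q k ≤ 2 := by
  have hq' : (2 : ℝ) ≤ q := by exact_mod_cast hq
  induction k with
  | zero => rw [geomCoef_zero]; norm_num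
  | succ k ih =>
    rw [geomCoef_succ]
    have : geomCoef q k / q ≤ 1 := (div_le_one (by linarith)).2 (ih.trans hq')
    linarith

section Rooted

variable {V : Type*} {G : SimpleGraph V} [G.LocallyFinite] {q : ℕ} {o : V}

/-- The function that grows like `geomCoef` on the sector of `y` and vanishes elsewhere. It is
harmonic except at the parent of `y`. -/
noncomputable def sectorWave (G : SimpleGraph V) (q : ℕ) (o y x : V) : ℝ :=
  (sector G o y).indicator (fun x => geomCoef q (G.dist o x - G.dist o y + 1)) x

/-- The harmonic function obtained from `sectorWave` at `y` by subtracting the mean over all the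
children of the parent of `y`. -/
noncomputable def sectorHarmonic (G : SimpleGraph V) [G.LocallyFinite] (q : ℕ) (o y x : V) : ℝ :=
  sectorWave G q o y x - (∑ y' ∈ children G o (parent G o y), sectorWave G q o y' x) /
    (children G o (parent G o y)).card

omit [G.LocallyFinite] in
theorem sectorWave_of_mem {x y : V} (h : x ∈ sector G o y) :
    sectorWave G q o y x = geomCoef q (G.dist o x - G.dist o y + 1) :=
  Set.indicator_of_mem h _

omit [G.LocallyFinite] in
theorem sectorWave_of_notMem {x y : V} (h : x ∉ sector G o y) : sectorWave G q o y x = 0 :=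
  Set.indicator_of_notMem h _

omit [G.LocallyFinite] in
theorem sectorWave_nonneg (y x : V) : 0 ≤ sectorWave G q o y x :=
  Set.indicator_nonneg (fun _ _ => geomCoef_nonneg q _) x

omit [G.LocallyFinite] in
theorem sectorWave_le_two (hq : 2 ≤ q) (y x : V) : sectorWave G q o y x ≤ 2 :=
  Set.indicator_apply_le' (fun _ => geomCoef_le_two hq _) fun _ => by norm_num

omit [G.LocallyFinite] in
theorem eq_of_adj_of_mem_sector (hG : G.IsTree) {x u y : V} (h : G.Adj x u)
    (hx : x ∉ sector G o y) (hu : u ∈ sector G o y) : u = y := by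
  by_contra hne
  have hxy : x ≠ y := by rintro rfl; exact hx (self_mem_sector x)
  rcases (adj_iff_parent (o := o) hG).1 h with ⟨-, rfl⟩ | ⟨-, rfl⟩
  · exact hx ((parent_mem_sector_iff hG hxy).1 hu)
  · exact hx ((parent_mem_sector_iff hG hne).2 hu)

-- Inside the sector harmonicity is the recurrence q a(k+2) + a(k) = (q+1) a(k+1) for a =
-- `geomCoef`; it persists at y because a(0) = 0 matches the value outside. Off the sector only the
-- parent of y sees a nonzero neighbour, namely y with value a(1) = 1.
open Classical in
theorem sum_neighbors_sectorWave [hG : IsHomogeneousTree G q] {y : V} (hy : y ≠ o) (x : V) :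
    ∑ u ∈ G.neighborFinset x, sectorWave G q o y u =
      (q + 1) * sectorWave G q o y x + if x = parent G o y then 1 else 0 := by
  have hT := hG.isTree
  have hq0 : (q : ℝ) ≠ 0 := by have := hG.two_le; positivity
  have hdy := dist_parent_add_one hT hy
  by_cases hx : x ∈ sector G o y
  · have hxo : x ≠ o := by
      rintro rfl
      have := dist_le_of_mem_sector hx
      have := (dist_pos hT).2 hy
      rw [SimpleGraph.dist_self] at *
      omega
    have hle := dist_le_of_mem_sector hx
    have hne : x ≠ parent G o y := by rintro rfl; omega
    obtain ⟨k, hk⟩ := Nat.exists_eq_add_of_le hle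
    rw [if_neg hne, add_zero, sum_neighborFinset hT hxo, sectorWave_of_mem hx]
    have hc : ∀ c ∈ children G o x, sectorWave G q o y c = geomCoef q (k + 2) := by
      intro c hc
      have hd := dist_of_mem_children hT hc
      have hcy : c ≠ y := by rintro rfl; omega
      rw [sectorWave_of_mem ((parent_mem_sector_iff hT hcy).1
        (by rwa [((mem_children hT).1 hc).2]))]
      congr 1; omega
    rw [Finset.sum_congr rfl hc, Finset.sum_const, card_children_of_ne_root (q := q) hxo,
      nsmul_eq_mul]
    have hp : sectorWave G q o y (parent G o x) = geomCoef q k := by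
      by_cases hxy : x = y
      · subst hxy
        have : k = 0 := by omega
        rw [this, geomCoef_zero, sectorWave_of_notMem]
        intro h
        have := dist_le_of_mem_sector h
        omega
      · have h := (parent_mem_sector_iff hT hxy).2 hx
        have := dist_le_of_mem_sector h
        have := dist_parent_add_one hT hxo
        rw [sectorWave_of_mem h]
        congr 1; omega
    rw [hp, show G.dist o x - G.dist o y + 1 = k + 1 by omega, geomCoef_succ q (k + 1),
      geomCoef_succ q k]
    field_simp
    ring
  · rw [sectorWave_of_notMem hx, mul_zero, zero_add]
    split_ifs with h
    · rw [Finset.sum_eq_single y, sectorWave_of_mem (self_mem_sector y), Nat.sub_self, zero_add,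
        geomCoef_one]
      · intro u hu huy
        exact sectorWave_of_notMem fun hu' => huy (eq_of_adj_of_mem_sector hT
          (by simpa using hu) hx hu')
      · intro h'
        subst h
        exact absurd (by simpa using (adj_parent hT hy).symm) h'
    · refine Finset.sum_eq_zero fun u hu => sectorWave_of_notMem fun hu' => ?_
      have hadj : G.Adj x u := by simpa using hu
      have := eq_of_adj_of_mem_sector hT hadj hx hu'
      subst this
      rcases (adj_iff_parent (o := o) hT).1 hadj with ⟨h1, h2⟩ | ⟨-, h2⟩
      · have hxu : x ≠ u := hadj.ne
        exact hx ((parent_mem_sector_iff hT hxu).1 (h2 ▸ self_mem_sector u))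
      · exact h h2.symm

theorem card_children_pos [hG : IsHomogeneousTree G q] (x : V) :
    0 < (children G o x).card := by
  have := hG.two_le
  by_cases hx : x = o
  · subst hx; rw [card_children_root (q := q)]; omega
  · rw [card_children_of_ne_root (q := q) hx]; omega

/-- All siblings have the same unit defect at the common parent, so subtracting their mean cancels
it. -/
theorem sum_neighbors_sectorHarmonic [hG : IsHomogeneousTree G q] {y : V} (hy : y ≠ o) (x : V) :
    ∑ u ∈ G.neighborFinset x, sectorHarmonic G q o y u = (q + 1) * sectorHarmonic G q o y x := by
  classical
  have hT := hG.isTree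
  have hc : ((children G o (parent G o y)).card : ℝ) ≠ 0 := by
    have := card_children_pos (G := G) (q := q) (o := o) (parent G o y)
    positivity
  simp only [sectorHarmonic, Finset.sum_sub_distrib, ← Finset.sum_div]
  rw [Finset.sum_comm, sum_neighbors_sectorWave hy]
  have h : ∀ y' ∈ children G o (parent G o y), ∑ u ∈ G.neighborFinset x, sectorWave G q o y' u =
      (q + 1) * sectorWave G q o y' x + if x = parent G o y then 1 else 0 := by
    intro y' hy'
    obtain ⟨h1, h2⟩ := (mem_children hT).1 hy'
    rw [sum_neighbors_sectorWave h1, h2]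
  rw [Finset.sum_congr rfl h, Finset.sum_add_distrib, ← Finset.mul_sum, Finset.sum_const,
    nsmul_eq_mul]
  field_simp
  ring

theorem abs_sectorHarmonic_le [hG : IsHomogeneousTree G q] (y x : V) :
    |sectorHarmonic G q o y x| ≤ (sector G o (parent G o y)).indicator (fun _ => 2) x := by
  have hT := hG.isTree
  have hc : 0 < ((children G o (parent G o y)).card : ℝ) := by
    exact_mod_cast card_children_pos (G := G) (q := q) (o := o) (parent G o y)
  by_cases hx : x ∈ sector G o (parent G o y)
  · rw [Set.indicator_of_mem hx, abs_le, sectorHarmonic]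
    have h1 := sectorWave_nonneg (G := G) (q := q) (o := o) y x
    have h2 := sectorWave_le_two (G := G) (o := o) hG.two_le y x
    have h3 : 0 ≤ (∑ y' ∈ children G o (parent G o y), sectorWave G q o y' x) /
        (children G o (parent G o y)).card :=
      div_nonneg (Finset.sum_nonneg fun y' _ => sectorWave_nonneg y' x) hc.le
    have h4 : (∑ y' ∈ children G o (parent G o y), sectorWave G q o y' x) /
        (children G o (parent G o y)).card ≤ 2 := by
      rw [div_le_iff₀ hc]
      refine (Finset.sum_le_card_nsmul _ _ 2 fun y' _ => sectorWave_le_two hG.two_le y' x).trans ?_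
      rw [nsmul_eq_mul, mul_comm]
    constructor <;> linarith
  · rw [Set.indicator_of_notMem hx, sectorHarmonic, sectorWave_of_notMem, Finset.sum_eq_zero]
    · simp
    · intro y' hy'
      refine sectorWave_of_notMem fun h => hx ?_
      rw [← ((mem_children hT).1 hy').2]
      exact mem_sector_parent hT h
    · exact fun h => hx (mem_sector_parent hT h)

/-! ### Generation sums and sibling deviations of harmonic functions. -/

theorem IsHarmonic.sum_neighbors [IsHomogeneousTree G q] {g : V → ℂ} (hg : IsHarmonic G q g)
    (x : V) : ∑ u ∈ G.neighborFinset x, g u = ((q : ℂ) + 1) * g x := by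
  have h : (q : ℂ) + 1 ≠ 0 := by exact_mod_cast Nat.succ_ne_zero q
  rw [hg x]
  field_simp

theorem isHarmonic_of_sum_neighbors {g : V → ℂ}
    (h : ∀ x, ∑ u ∈ G.neighborFinset x, g u = ((q : ℂ) + 1) * g x) : IsHarmonic G q g := by
  intro x
  have h' : (q : ℂ) + 1 ≠ 0 := by exact_mod_cast Nat.succ_ne_zero q
  rw [h x]
  field_simp

theorem IsHarmonic.sum_children [hG : IsHomogeneousTree G q] {g : V → ℂ} (hg : IsHarmonic G q g)
    {y : V} (hy : y ≠ o) :
    ∑ c ∈ children G o y, g c = (q : ℂ) * g y + (g y - g (parent G o y)) := by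
  have h := hg.sum_neighbors y
  rw [sum_neighborFinset hG.isTree hy] at h
  linear_combination h

theorem IsHarmonic.sum_children_root [hG : IsHomogeneousTree G q] {g : V → ℂ}
    (hg : IsHarmonic G q g) : ∑ c ∈ children G o o, g c = ((q : ℂ) + 1) * g o := by
  rw [children_root hG.isTree, hg.sum_neighbors]

/-- By harmonicity the mean increment of g over the children of y is q⁻¹ times the increment into y,
so the means over successive generations grow by a geometric series. -/
theorem IsHarmonic.sum_descendants [hG : IsHomogeneousTree G q] {g : V → ℂ}
    (hg : IsHarmonic G q g) (k : ℕ) {y : V} (hy : y ≠ o) :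
    ∑ x ∈ descendants G o k y, g x = (q : ℂ) ^ k * (g (parent G o y) +
      geomCoef q (k + 1) * (g y - g (parent G o y))) := by
  have hT := hG.isTree
  have hq0 : (q : ℂ) ≠ 0 := by have := hG.two_le; exact_mod_cast (by omega : q ≠ 0)
  induction k generalizing y with
  | zero => simp [descendants, geomCoef_one]
  | succ k ih =>
    rw [sum_descendants_succ hT]
    have h : ∀ c ∈ children G o y, ∑ x ∈ descendants G o k c, g x =
        (q : ℂ) ^ k * (g y + geomCoef q (k + 1) * (g c - g y)) := by
      intro c hc
      obtain ⟨h1, h2⟩ := (mem_children hT).1 hc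
      rw [ih h1, h2]
    rw [Finset.sum_congr rfl h, ← Finset.mul_sum, Finset.sum_add_distrib, ← Finset.mul_sum,
      Finset.sum_sub_distrib, hg.sum_children hy, Finset.sum_const,
      card_children_of_ne_root (q := q) hy, nsmul_eq_mul, geomCoef_succ q (k + 1), pow_succ]
    push_cast
    field_simp
    ring

theorem IsHarmonic.sum_descendants_root [hG : IsHomogeneousTree G q] {g : V → ℂ}
    (hg : IsHarmonic G q g) (k : ℕ) :
    ∑ x ∈ descendants G o k o, g x = (descendants G o k o).card * g o := by
  have hT := hG.isTree
  cases k with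
  | zero => simp [descendants]
  | succ k =>
    rw [sum_descendants_succ hT, card_descendants_root_succ (q := q)]
    have h : ∀ c ∈ children G o o, ∑ x ∈ descendants G o k c, g x =
        (q : ℂ) ^ k * (g o + geomCoef q (k + 1) * (g c - g o)) := by
      intro c hc
      obtain ⟨h1, h2⟩ := (mem_children hT).1 hc
      rw [hg.sum_descendants k h1, h2]
    rw [Finset.sum_congr rfl h, ← Finset.mul_sum, Finset.sum_add_distrib, ← Finset.mul_sum,
      Finset.sum_sub_distrib, hg.sum_children_root, Finset.sum_const,
      card_children_root (q := q), nsmul_eq_mul]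
    push_cast
    ring

/-- The deviation of `g y` from the mean of `g` over the children of the parent of `y`. -/
noncomputable def siblingDeviation (G : SimpleGraph V) [G.LocallyFinite] (o : V) (g : V → ℂ)
    (y : V) : ℂ :=
  g y - (∑ c ∈ children G o (parent G o y), g c) / (children G o (parent G o y)).card

/-- Harmonicity at the parent expresses the sibling mean by the preceding increment. If the parent
is the root, the convention that the root is its own parent makes that increment zero, as it should
be. -/
theorem IsHarmonic.siblingDeviation_eq [hG : IsHomogeneousTree G q] {g : V → ℂ}
    (hg : IsHarmonic G q g) (y : V) :
    siblingDeviation G o g y = (g y - g (parent G o y)) -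
      (g (parent G o y) - g (parent G o (parent G o y))) / q := by
  have hq0 : (q : ℂ) ≠ 0 := by have := hG.two_le; exact_mod_cast (by omega : q ≠ 0)
  have hq1 : (q : ℂ) + 1 ≠ 0 := by exact_mod_cast Nat.succ_ne_zero q
  rw [siblingDeviation]
  by_cases h : parent G o y = o
  · rw [h, parent_root, hg.sum_children_root, card_children_root (q := q)]
    push_cast
    field_simp
    ring
  · rw [hg.sum_children h, card_children_of_ne_root (q := q) h]
    field_simp
    ring

/-- With d(i) the increment of g into the i-th ancestor of z, the deviation is d(i) - d(i+1)/q. The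
recurrence a(i+1) - a(i)/q = 1 for `geomCoef` turns the weighted sum into the sum of the d(i); the
boundary term vanishes at the root. -/
theorem IsHarmonic.sum_siblingDeviation [hG : IsHomogeneousTree G q] {g : V → ℂ}
    (hg : IsHarmonic G q g) (z : V) :
    ∑ i ∈ Finset.range (G.dist o z), (geomCoef q (i + 1) : ℂ) *
      siblingDeviation G o g ((parent G o)^[i] z) = g z - g o := by
  have hq0 : (q : ℂ) ≠ 0 := by have := hG.two_le; exact_mod_cast (by omega : q ≠ 0)
  have key : ∀ m, ∑ i ∈ Finset.range m, (geomCoef q (i + 1) : ℂ) *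
      siblingDeviation G o g ((parent G o)^[i] z) = g z - g ((parent G o)^[m] z) -
        geomCoef q m * (g ((parent G o)^[m] z) - g (parent G o ((parent G o)^[m] z))) / q := by
    intro m
    induction m with
    | zero => simp [geomCoef_zero]
    | succ m ih =>
      rw [Finset.sum_range_succ, ih, hg.siblingDeviation_eq, Function.iterate_succ_apply',
        geomCoef_succ]
      push_cast
      field_simp
      ring
  rw [key, iterate_parent_dist hG.isTree, parent_root]
  simp

end Rooted

/-! ### The explicit reproducing kernel for a radial density. -/

section Reproducing

variable {V : Type*} {G : SimpleGraph V} [G.LocallyFinite] {q : ℕ} {o : V} {r : ℝ}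

/-- The squared norm of the radial profile of the harmonic functions `sectorHarmonic`, for the
radial density `r ^ |x|`. -/
noncomputable def profileNormSq (q : ℕ) (r : ℝ) : ℝ :=
  ∑' k : ℕ, r * (q * r) ^ k * geomCoef q (k + 1) ^ 2

theorem summable_profile (hq : 2 ≤ q) (hr : 0 < r) (hqr : q * r < 1) (n : ℕ) :
    Summable fun k : ℕ => r * (q * r) ^ k * geomCoef q (k + 1) ^ n := by
  have h : Summable fun k : ℕ => r * 2 ^ n * (q * r) ^ k :=
    (summable_geometric_of_lt_one (by positivity) hqr).mul_left _
  refine h.of_nonneg_of_le (fun k => ?_) fun k => ?_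
  · have := geomCoef_nonneg q (k + 1)
    positivity
  · have := pow_le_pow_left₀ (geomCoef_nonneg q (k + 1)) (geomCoef_le_two hq (k + 1)) n
    have h0 : 0 ≤ r * (q * r) ^ k := by positivity
    calc _ ≤ r * (q * r) ^ k * 2 ^ n := mul_le_mul_of_nonneg_left this h0
      _ = _ := by ring

theorem profileNormSq_pos (hq : 2 ≤ q) (hr : 0 < r) (hqr : q * r < 1) :
    0 < profileNormSq q r := by
  refine (summable_profile hq hr hqr 2).tsum_pos (fun k => ?_) 0 ?_
  · have := geomCoef_nonneg q (k + 1)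
    positivity
  · simpa [geomCoef_one] using hr

/-- The wave is constant on each generation, so only the generation sums of g enter. The coefficient
of g(p(y)) is the same for all siblings and disappears once their mean is subtracted; what then
survives is `profileNormSq` times the deviation. -/
theorem tsum_sectorWave_mul [hG : IsHomogeneousTree G q] (hr : 0 < r) (hqr : q * r < 1)
    {g : V → ℂ} (hg : IsHarmonic G q g) (hs : Summable fun x => (r : ℂ) ^ G.dist o x * g x)
    {y : V} (hy : y ≠ o) :
    Summable (fun x => (r : ℂ) ^ G.dist o x * (sectorWave G q o y x * g x)) ∧
    ∑' x, (r : ℂ) ^ G.dist o x * (sectorWave G q o y x * g x) =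
      (r : ℂ) ^ G.dist o (parent G o y) *
        ((∑' k : ℕ, r * (q * r) ^ k * geomCoef q (k + 1) ^ 1 : ℝ) * g (parent G o y) +
          profileNormSq q r * (g y - g (parent G o y))) := by
  have hT := hG.isTree
  set F : V → ℂ := fun x => (r : ℂ) ^ G.dist o x *
    (geomCoef q (G.dist o x - G.dist o y + 1) * g x) with hF
  have hFs : Summable F := by
    refine Summable.of_norm_bounded (hs.norm.mul_left 2) fun x => ?_
    have h1 := geomCoef_le_two hG.two_le (G.dist o x - G.dist o y + 1)
    have h0 := geomCoef_nonneg q (G.dist o x - G.dist o y + 1)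
    rw [hF]
    simp only [norm_mul, Complex.norm_real, Real.norm_of_nonneg h0]
    have : 0 ≤ ‖(r : ℂ) ^ G.dist o x‖ * ‖g x‖ := by positivity
    nlinarith
  have hind : (fun x => (r : ℂ) ^ G.dist o x * (sectorWave G q o y x * g x)) =
      (sector G o y).indicator F := by
    funext x
    by_cases hx : x ∈ sector G o y
    · rw [sectorWave_of_mem hx, Set.indicator_of_mem hx]
    · rw [sectorWave_of_notMem hx, Set.indicator_of_notMem hx]; simp
  rw [hind]
  refine ⟨hFs.indicator _, ?_⟩
  rw [tsum_sector hT y hFs]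
  have hd := dist_parent_add_one hT hy
  have hk : ∀ k, ∑ x ∈ descendants G o k y, F x = (r : ℂ) ^ G.dist o (parent G o y) *
      ((r * (q * r) ^ k * geomCoef q (k + 1) ^ 1 : ℝ) * g (parent G o y) +
        (r * (q * r) ^ k * geomCoef q (k + 1) ^ 2 : ℝ) * (g y - g (parent G o y))) := by
    intro k
    have : ∀ x ∈ descendants G o k y, F x =
        (r : ℂ) ^ (G.dist o (parent G o y) + 1 + k) * geomCoef q (k + 1) * g x := by
      intro x hx
      have h := ((mem_descendants hT).1 hx).1
      rw [hF]
      simp only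
      rw [h, Nat.add_sub_cancel_left, ← hd]
      ring
    rw [Finset.sum_congr rfl this, ← Finset.mul_sum, hg.sum_descendants k hy]
    push_cast
    ring
  rw [tsum_congr hk, tsum_mul_left, Summable.tsum_add, tsum_mul_right, tsum_mul_right,
    ← Complex.ofReal_tsum, ← Complex.ofReal_tsum, profileNormSq]
  · exact (Complex.hasSum_ofReal.2 (summable_profile hG.two_le hr hqr 1).hasSum).summable.mul_right _
  · exact (Complex.hasSum_ofReal.2 (summable_profile hG.two_le hr hqr 2).hasSum).summable.mul_right _

theorem tsum_sectorHarmonic_mul [hG : IsHomogeneousTree G q] (hr : 0 < r) (hqr : q * r < 1)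
    {g : V → ℂ} (hg : IsHarmonic G q g) (hs : Summable fun x => (r : ℂ) ^ G.dist o x * g x)
    {y : V} (hy : y ≠ o) :
    Summable (fun x => (r : ℂ) ^ G.dist o x * (sectorHarmonic G q o y x * g x)) ∧
    ∑' x, (r : ℂ) ^ G.dist o x * (sectorHarmonic G q o y x * g x) =
      (r : ℂ) ^ G.dist o (parent G o y) * (profileNormSq q r * siblingDeviation G o g y) := by
  have hT := hG.isTree
  have hc : ((children G o (parent G o y)).card : ℂ) ≠ 0 := by
    exact_mod_cast (card_children_pos (G := G) (q := q) (o := o) (parent G o y)).ne'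
  have h1 := tsum_sectorWave_mul hr hqr hg hs hy
  have h2 : ∀ y' ∈ children G o (parent G o y), _ := fun y' hy' =>
    tsum_sectorWave_mul (y := y') hr hqr hg hs ((mem_children hT).1 hy').1
  have hs2 := summable_sum (s := children G o (parent G o y)) fun y' hy' => (h2 y' hy').1
  have e : (fun x => (r : ℂ) ^ G.dist o x * (sectorHarmonic G q o y x * g x)) = fun x =>
      (r : ℂ) ^ G.dist o x * (sectorWave G q o y x * g x) -
      (∑ y' ∈ children G o (parent G o y), (r : ℂ) ^ G.dist o x * (sectorWave G q o y' x * g x)) /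
        (children G o (parent G o y)).card := by
    funext x
    rw [sectorHarmonic, ← Finset.mul_sum, ← Finset.sum_mul]
    push_cast
    ring
  rw [e]
  refine ⟨h1.1.sub (hs2.div_const _), ?_⟩
  rw [h1.1.tsum_sub (hs2.div_const _), tsum_div_const,
    Summable.tsum_finsetSum fun y' hy' => (h2 y' hy').1, h1.2,
    Finset.sum_congr rfl fun y' hy' => (h2 y' hy').2, siblingDeviation]
  have h3 : ∀ y' ∈ children G o (parent G o y),
      (r : ℂ) ^ G.dist o (parent G o y') *
        ((∑' k : ℕ, r * (q * r) ^ k * geomCoef q (k + 1) ^ 1 : ℝ) * g (parent G o y') +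
          profileNormSq q r * (g y' - g (parent G o y'))) =
      (r : ℂ) ^ G.dist o (parent G o y) *
        ((∑' k : ℕ, r * (q * r) ^ k * geomCoef q (k + 1) ^ 1 : ℝ) * g (parent G o y) +
          profileNormSq q r * (g y' - g (parent G o y))) := by
    intro y' hy'
    rw [((mem_children hT).1 hy').2]
  rw [Finset.sum_congr rfl h3, ← Finset.mul_sum, Finset.sum_add_distrib, ← Finset.mul_sum,
    ← Finset.mul_sum, Finset.sum_sub_distrib, Finset.sum_const, nsmul_eq_mul]
  field_simp
  ring

/-- Mean value property on spheres about the root. This is the pairing with constants, which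
supplies the first term of the kernel. -/
theorem IsHarmonic.tsum_eq [hG : IsHomogeneousTree G q]
    {g : V → ℂ} (hg : IsHarmonic G q g) (hs : Summable fun x => (r : ℂ) ^ G.dist o x * g x)
    (hs1 : Summable fun x => r ^ G.dist o x) :
    ∑' x, (r : ℂ) ^ G.dist o x * g x = (∑' x, r ^ G.dist o x : ℝ) * g o := by
  have hT := hG.isTree
  have hs1' : Summable fun x => (r : ℂ) ^ G.dist o x := by
    simpa using (Complex.hasSum_ofReal.2 hs1.hasSum).summable
  have key : ∀ (h : V → ℂ) (k : ℕ), ∑ x ∈ descendants G o k o, (r : ℂ) ^ G.dist o x * h x =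
      (r : ℂ) ^ k * ∑ x ∈ descendants G o k o, h x := by
    intro h k
    rw [Finset.mul_sum]
    refine Finset.sum_congr rfl fun x hx => ?_
    rw [((mem_descendants hT).1 hx).1, SimpleGraph.dist_self, zero_add]
  have h1 := tsum_sector (o := o) hT o hs
  have h2 := tsum_sector (o := o) hT o (f := fun x => (r : ℂ) ^ G.dist o x * 1) (by simpa using hs1')
  rw [sector_root hT] at h1 h2
  simp only [Set.indicator_univ, key] at h1 h2
  rw [h1, Complex.ofReal_tsum]
  push_cast
  simp only [mul_one, Finset.sum_const, nsmul_eq_mul] at h2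
  rw [h2, ← tsum_mul_right]
  refine tsum_congr fun k => ?_
  rw [hg.sum_descendants_root]
  ring

/-- The explicit form of the reproducing kernel for the radial density `r ^ |x|`. -/
noncomputable def explicitKernel (G : SimpleGraph V) [G.LocallyFinite] (q : ℕ) (o : V) (r : ℝ)
    (z x : V) : ℝ :=
  (∑' x, r ^ G.dist o x)⁻¹ + (profileNormSq q r)⁻¹ * ∑ i ∈ Finset.range (G.dist o z),
    (r ^ G.dist o (parent G o ((parent G o)^[i] z)))⁻¹ * geomCoef q (i + 1) *
      sectorHarmonic G q o ((parent G o)^[i] z) x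

theorem explicitKernel_root (x : V) :
    explicitKernel G q o r o x = (∑' x, r ^ G.dist o x)⁻¹ := by
  simp [explicitKernel]

omit [G.LocallyFinite] in
theorem iterate_parent_ne_root (hG : G.IsTree) {z : V} {i : ℕ} (hi : i < G.dist o z) :
    (parent G o)^[i] z ≠ o := by
  rw [← dist_pos hG, dist_iterate_parent hG]; omega

/-- The constant term recovers g(o); the coefficients of the other terms are chosen so that their
pairings are exactly the summands of the telescoping identity for g(z) - g(o). -/
theorem tsum_explicitKernel_mul [hG : IsHomogeneousTree G q] (hr : 0 < r) (hqr : q * r < 1)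
    {g : V → ℂ} (hg : IsHarmonic G q g) (hs : Summable fun x => (r : ℂ) ^ G.dist o x * g x)
    (hs1 : Summable fun x => r ^ G.dist o x) (z : V) :
    ∑' x, (r : ℂ) ^ G.dist o x * (explicitKernel G q o r z x * g x) = g z := by
  have hT := hG.isTree
  have hB : (profileNormSq q r : ℂ) ≠ 0 := by
    exact_mod_cast (profileNormSq_pos hG.two_le hr hqr).ne'
  have hM : ((∑' x, r ^ G.dist o x : ℝ) : ℂ) ≠ 0 := by
    exact_mod_cast (hs1.tsum_pos (fun x => by positivity) o (by positivity)).ne'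
  have hr' : (r : ℂ) ≠ 0 := by exact_mod_cast hr.ne'
  have h1 : ∀ i ∈ Finset.range (G.dist o z), _ := fun i hi =>
    tsum_sectorHarmonic_mul hr hqr hg hs (iterate_parent_ne_root hT (Finset.mem_range.1 hi))
  set c : ℕ → ℂ := fun i => (profileNormSq q r : ℂ)⁻¹ *
    (((r : ℂ) ^ G.dist o (parent G o ((parent G o)^[i] z)))⁻¹ * geomCoef q (i + 1)) with hc
  have e : (fun x => (r : ℂ) ^ G.dist o x * (explicitKernel G q o r z x * g x)) = fun x =>
      ((∑' x, r ^ G.dist o x : ℝ) : ℂ)⁻¹ * ((r : ℂ) ^ G.dist o x * g x) +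
      ∑ i ∈ Finset.range (G.dist o z), c i * ((r : ℂ) ^ G.dist o x *
        (sectorHarmonic G q o ((parent G o)^[i] z) x * g x)) := by
    funext x
    rw [explicitKernel, Complex.ofReal_add, add_mul, mul_add, Complex.ofReal_mul,
      Complex.ofReal_sum, Finset.mul_sum, Finset.sum_mul, Finset.mul_sum, Complex.ofReal_inv,
      Complex.ofReal_inv]
    congr 1
    · ring
    · refine Finset.sum_congr rfl fun i _ => ?_
      rw [hc]
      push_cast
      ring
  have hsum : ∀ i ∈ Finset.range (G.dist o z), Summable fun x => c i * ((r : ℂ) ^ G.dist o x *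
        (sectorHarmonic G q o ((parent G o)^[i] z) x * g x)) :=
    fun i hi => (h1 i hi).1.mul_left _
  rw [e, Summable.tsum_add (hs.mul_left _) (summable_sum hsum), tsum_mul_left,
    hg.tsum_eq hs hs1, Summable.tsum_finsetSum hsum, inv_mul_cancel_left₀ hM]
  have h2 : ∀ i ∈ Finset.range (G.dist o z), ∑' x, c i * ((r : ℂ) ^ G.dist o x *
        (sectorHarmonic G q o ((parent G o)^[i] z) x * g x)) =
      geomCoef q (i + 1) * siblingDeviation G o g ((parent G o)^[i] z) := by
    intro i hi
    rw [tsum_mul_left, (h1 i hi).2, hc]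
    field_simp
  rw [Finset.sum_congr rfl h2, hg.sum_siblingDeviation]
  ring

theorem sum_neighbors_explicitKernel [hG : IsHomogeneousTree G q] (z x : V) :
    ∑ u ∈ G.neighborFinset x, explicitKernel G q o r z u =
      (q + 1) * explicitKernel G q o r z x := by
  have hT := hG.isTree
  simp only [explicitKernel, Finset.sum_add_distrib, ← Finset.mul_sum]
  rw [Finset.sum_comm, mul_add, Finset.sum_const, G.card_neighborFinset_eq_degree,
    hG.isRegular.degree_eq, nsmul_eq_mul, mul_left_comm ((q : ℝ) + 1)]
  push_cast
  rw [Finset.mul_sum (a := (q : ℝ) + 1)]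
  congr 2
  refine Finset.sum_congr rfl fun i hi => ?_
  rw [← Finset.mul_sum, sum_neighbors_sectorHarmonic
    (iterate_parent_ne_root hT (Finset.mem_range.1 hi))]
  ring

/-- Each summand of the kernel lives in the sector of an ancestor of z, so it contributes only when
that vertex is also an ancestor of x. -/
theorem exists_abs_explicitKernel_le [hG : IsHomogeneousTree G q] (hr : 0 < r) (hqr : q * r < 1)
    (hs1 : Summable fun x => r ^ G.dist o x) :
    ∃ C : ℝ, 0 < C ∧ ∀ z x, |explicitKernel G q o r z x| ≤
      C * ∑ i ∈ Finset.range (G.dist o z + 1),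
        {v | x ∈ sector G o v}.indicator (fun v => (r ^ G.dist o v)⁻¹) ((parent G o)^[i] z) := by
  have hT := hG.isTree
  have hB := profileNormSq_pos hG.two_le hr hqr
  have hM : 0 < ∑' x, r ^ G.dist o x := hs1.tsum_pos (fun x => by positivity) o (by positivity)
  set M := ∑' x, r ^ G.dist o x
  set B := profileNormSq q r
  -- The 4 is the product of the bounds 2 for `geomCoef` and 2 for `sectorHarmonic`.
  refine ⟨M⁻¹ + B⁻¹ * 4, by positivity, fun z x => ?_⟩
  set F : V → ℝ := {v | x ∈ sector G o v}.indicator (fun v => (r ^ G.dist o v)⁻¹) with hF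
  have hF0 : ∀ v, 0 ≤ F v := fun v => Set.indicator_nonneg (fun _ _ => by positivity) v
  have hFo : F o = 1 := by
    rw [hF, Set.indicator_of_mem (by simp [sector_root hT])]
    simp
  -- The root is always a common ancestor; its term absorbs the constant part of the kernel.
  have hS0 : 1 ≤ ∑ i ∈ Finset.range (G.dist o z + 1), F ((parent G o)^[i] z) := by
    rw [← hFo, ← congrArg F (iterate_parent_dist hT z)]
    exact Finset.single_le_sum (f := fun i => F ((parent G o)^[i] z)) (fun i _ => hF0 _)
      (Finset.mem_range.2 (Nat.lt_succ_self _))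
  have hS1 : |∑ i ∈ Finset.range (G.dist o z),
    (r ^ G.dist o (parent G o ((parent G o)^[i] z)))⁻¹ * geomCoef q (i + 1) *
      sectorHarmonic G q o ((parent G o)^[i] z) x| ≤
      4 * ∑ i ∈ Finset.range (G.dist o z + 1), F ((parent G o)^[i] z) := by
    -- The i-th summand is controlled by the ancestor of index i + 1, so the majorant is shifted and
    -- its term at z itself dropped.
    rw [Finset.sum_range_succ']
    refine le_trans ?_ (mul_le_mul_of_nonneg_left (le_add_of_nonneg_right (hF0 _)) (by norm_num))
    rw [Finset.mul_sum]
    refine (Finset.abs_sum_le_sum_abs _ _).trans (Finset.sum_le_sum fun i _ => ?_)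
    rw [Function.iterate_succ_apply']
    set y := (parent G o)^[i] z
    have h1 := abs_sectorHarmonic_le (G := G) (q := q) (o := o) y x
    have h2 := geomCoef_nonneg q (i + 1)
    have h3 := geomCoef_le_two hG.two_le (i + 1)
    have h4 : 0 < (r ^ G.dist o (parent G o y))⁻¹ := by positivity
    rw [abs_mul, abs_mul, abs_of_pos h4, abs_of_nonneg h2]
    by_cases hx : x ∈ sector G o (parent G o y)
    · rw [Set.indicator_of_mem hx] at h1
      rw [hF, Set.indicator_of_mem (by exact hx)]
      calc _ ≤ (r ^ G.dist o (parent G o y))⁻¹ * 2 * 2 := by gcongr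
        _ = _ := by ring
    · rw [Set.indicator_of_notMem hx] at h1
      have : |sectorHarmonic G q o y x| = 0 := le_antisymm h1 (abs_nonneg _)
      rw [this, mul_zero]
      exact mul_nonneg (by norm_num) (hF0 _)
  rw [explicitKernel]
  refine (abs_add_le _ _).trans ?_
  rw [abs_mul, abs_of_pos (inv_pos.2 hM), abs_of_pos (inv_pos.2 hB), add_mul]
  refine add_le_add (le_mul_of_one_le_right (by positivity) hS0) ?_
  rw [mul_assoc]
  gcongr

end Reproducing

/-! ### Powers of q and geometric sums over sectors and ancestors. -/

/-- The power `q ^ s`, as an extended nonnegative real. -/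
noncomputable def qpow (q : ℕ) (s : ℝ) : ℝ≥0∞ := ENNReal.ofReal ((q : ℝ) ^ s)

theorem qpow_ne_top (q : ℕ) (s : ℝ) : qpow q s ≠ ∞ := ENNReal.ofReal_ne_top

theorem qpow_ne_zero {q : ℕ} (hq : 2 ≤ q) (s : ℝ) : qpow q s ≠ 0 := by
  have : (0 : ℝ) < q := by exact_mod_cast (by omega : 0 < q)
  exact (ENNReal.ofReal_pos.2 (Real.rpow_pos_of_pos this s)).ne'

theorem qpow_add {q : ℕ} (hq : 2 ≤ q) (s t : ℝ) : qpow q (s + t) = qpow q s * qpow q t := by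
  have : (0 : ℝ) < q := by exact_mod_cast (by omega : 0 < q)
  rw [qpow, qpow, qpow, Real.rpow_add this, ENNReal.ofReal_mul (by positivity)]

theorem qpow_zero (q : ℕ) : qpow q 0 = 1 := by simp [qpow]

theorem qpow_rpow {q : ℕ} (hq : 2 ≤ q) (s t : ℝ) : qpow q s ^ t = qpow q (s * t) := by
  have : (0 : ℝ) < q := by exact_mod_cast (by omega : 0 < q)
  rw [qpow, qpow, ENNReal.ofReal_rpow_of_pos (Real.rpow_pos_of_pos this s), Real.rpow_mul this.le]

theorem qpow_pow {q : ℕ} (hq : 2 ≤ q) (s : ℝ) (n : ℕ) : qpow q s ^ n = qpow q (s * n) := by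
  rw [← ENNReal.rpow_natCast, qpow_rpow hq]

theorem qpow_natCast (q n : ℕ) : qpow q n = (q : ℝ≥0∞) ^ n := by
  rw [qpow, Real.rpow_natCast, ENNReal.ofReal_pow (by positivity), ENNReal.ofReal_natCast]

theorem qpow_lt_one {q : ℕ} (hq : 2 ≤ q) {s : ℝ} (hs : s < 0) : qpow q s < 1 := by
  have : (1 : ℝ) < q := by exact_mod_cast (by omega : 1 < q)
  rw [qpow, ENNReal.ofReal_lt_one]
  exact Real.rpow_lt_one_of_one_lt_of_neg this hs

theorem qpow_mono {q : ℕ} (hq : 2 ≤ q) {s t : ℝ} (h : s ≤ t) : qpow q s ≤ qpow q t := by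
  have : (1 : ℝ) ≤ q := by exact_mod_cast (by omega : 1 ≤ q)
  exact ENNReal.ofReal_le_ofReal (Real.rpow_le_rpow_of_exponent_le this h)

theorem tsum_qpow_ne_top {q : ℕ} (hq : 2 ≤ q) {s : ℝ} (hs : s < 0) :
    ∑' k : ℕ, qpow q s ^ k ≠ ∞ := by
  rw [ENNReal.tsum_geometric, ENNReal.inv_ne_top]
  exact (tsub_pos_of_lt (qpow_lt_one hq hs)).ne'

theorem rpow_neg_mul_natCast (q : ℕ) (β : ℝ) (n : ℕ) :
    (q : ℝ) ^ (-β * (n : ℝ)) = ((q : ℝ) ^ (-β)) ^ n := by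
  rw [Real.rpow_mul (Nat.cast_nonneg q), Real.rpow_natCast]

theorem rpow_neg_pos {q : ℕ} (hq : 2 ≤ q) (β : ℝ) : 0 < (q : ℝ) ^ (-β) :=
  Real.rpow_pos_of_pos (by exact_mod_cast (by omega : 0 < q)) _

theorem mul_rpow_neg_lt_one {q : ℕ} (hq : 2 ≤ q) {β : ℝ} (hβ : 1 < β) :
    (q : ℝ) * (q : ℝ) ^ (-β) < 1 := by
  have h1 : (1 : ℝ) < q := by exact_mod_cast (by omega : 1 < q)
  have : (q : ℝ) * (q : ℝ) ^ (-β) = (q : ℝ) ^ (1 - β) := by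
    rw [sub_eq_add_neg, Real.rpow_add (by linarith), Real.rpow_one]
  rw [this]
  exact Real.rpow_lt_one_of_one_lt_of_neg h1 (by linarith)

section Rooted

variable {V : Type*} {G : SimpleGraph V} [G.LocallyFinite] {q : ℕ} {o : V}

/-- Generation k has at most 2 q^k vertices, so the sum is dominated by a geometric series of ratio
q^(1-γ). -/
theorem exists_tsum_sector_le [hG : IsHomogeneousTree G q] {γ : ℝ} (hγ : 1 < γ) :
    ∃ C ≠ ∞, ∀ y, ∑' x, (sector G o y).indicator (fun x => qpow q (-γ * G.dist o x)) x ≤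
      C * qpow q (-γ * G.dist o y) := by
  have hT := hG.isTree
  have hq := hG.two_le
  refine ⟨2 * ∑' k : ℕ, qpow q (1 - γ) ^ k,
    ENNReal.mul_ne_top (by norm_num) (tsum_qpow_ne_top hq (by linarith)), fun y => ?_⟩
  rw [tsum_sector_ennreal hT, ← ENNReal.tsum_mul_left, ← ENNReal.tsum_mul_right]
  refine ENNReal.tsum_le_tsum fun k => ?_
  have h : ∀ x ∈ descendants G o k y, qpow q (-γ * G.dist o x) =
      qpow q (-γ * k) * qpow q (-γ * G.dist o y) := by
    intro x hx
    rw [((mem_descendants hT).1 hx).1, ← qpow_add hq]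
    congr 1
    push_cast
    ring
  have hcard : ((descendants G o k y).card : ℝ≥0∞) ≤ 2 * qpow q k := by
    rw [qpow_natCast]
    exact_mod_cast card_descendants_le q k y
  have hpow : qpow q (1 - γ) ^ k = qpow q k * qpow q (-γ * k) := by
    rw [← qpow_add hq, qpow_pow hq]
    congr 1
    ring
  rw [Finset.sum_congr rfl h, Finset.sum_const, nsmul_eq_mul, ← mul_assoc, hpow, ← mul_assoc]
  gcongr

omit [G.LocallyFinite] in
theorem exists_tsum_ancestors_le (hT : G.IsTree) (hq : 2 ≤ q) {s : ℝ} (hs : 0 < s) :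
    ∃ C ≠ ∞, ∀ z, ∑' v, {v | z ∈ sector G o v}.indicator (fun v => qpow q (s * G.dist o v)) v ≤
      C * qpow q (s * G.dist o z) := by
  refine ⟨∑' k : ℕ, qpow q (-s) ^ k, tsum_qpow_ne_top hq (by linarith), fun z => ?_⟩
  rw [tsum_ancestors hT, ← ENNReal.tsum_mul_right]
  refine le_trans (Finset.sum_le_sum fun i hi => ?_) (ENNReal.sum_le_tsum _)
  have hi' : i ≤ G.dist o z := Nat.lt_succ_iff.1 (Finset.mem_range.1 hi)
  rw [dist_iterate_parent hT, qpow_pow hq, ← qpow_add hq, Nat.cast_sub hi']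
  refine le_of_eq ?_
  congr 1
  ring

/-! ### Integration against the measure and identification of the kernel. -/

variable [MeasurableSpace V] [DiscreteMeasurableSpace V]

omit [G.LocallyFinite] in
theorem lintegral_mu (α : ℝ) (f : V → ℝ≥0∞) :
    ∫⁻ x, f x ∂(mu G q o α) = ∑' x, f x * qpow q (-α * G.dist o x) := by
  rw [mu, lintegral_withDensity_eq_lintegral_mul _ (Measurable.of_discrete)
    (Measurable.of_discrete), lintegral_count]
  exact tsum_congr fun x => mul_comm _ _

omit [MeasurableSpace V] [DiscreteMeasurableSpace V] in
theorem tsum_qpow_dist_ne_top [hG : IsHomogeneousTree G q] {α : ℝ} (hα : 1 < α) :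
    ∑' x, qpow q (-α * G.dist o x) ≠ ∞ := by
  obtain ⟨C, hC, h⟩ := exists_tsum_sector_le (G := G) (q := q) (o := o) hα
  have := h o
  rw [sector_root hG.isTree, Set.indicator_univ] at this
  exact (this.trans_lt (ENNReal.mul_lt_top hC.lt_top (qpow_ne_top q _).lt_top)).ne

theorem isFiniteMeasure_mu [hG : IsHomogeneousTree G q] {α : ℝ} (hα : 1 < α) :
    IsFiniteMeasure (mu G q o α) := by
  refine ⟨?_⟩
  rw [← lintegral_one, lintegral_mu]
  simpa using (tsum_qpow_dist_ne_top hα).lt_top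

theorem mu_real_singleton [hG : IsHomogeneousTree G q] (α : ℝ) (x : V) :
    (mu G q o α).real {x} = ((q : ℝ) ^ (-α)) ^ G.dist o x := by
  have := rpow_neg_pos hG.two_le α
  rw [Measure.real, mu_singleton, rpow_neg_mul_natCast, ENNReal.toReal_ofReal (by positivity)]

omit [G.LocallyFinite] in
theorem aestronglyMeasurable_mu (α : ℝ) (f : V → ℂ) :
    AEStronglyMeasurable f (mu G q o α) :=
  (Measurable.of_discrete (f := f)).aestronglyMeasurable

theorem summable_of_integrable_mu [hG : IsHomogeneousTree G q] {α : ℝ} {f : V → ℂ}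
    (hf : Integrable f (mu G q o α)) :
    Summable fun x => (((q : ℝ) ^ (-α) : ℝ) : ℂ) ^ G.dist o x * f x := by
  have := rpow_neg_pos hG.two_le α
  rw [mu, integrable_withDensity_iff_integrable_smul' Measurable.of_discrete (by simp),
    integrable_count_iff] at hf
  refine hf.of_norm.congr fun x => ?_
  rw [rpow_neg_mul_natCast, ENNReal.toReal_ofReal (by positivity)]
  simp

theorem integral_mu [hG : IsHomogeneousTree G q] {α : ℝ} {f : V → ℂ}
    (hf : Integrable f (mu G q o α)) :
    ∫ x, f x ∂(mu G q o α) = ∑' x, (((q : ℝ) ^ (-α) : ℝ) : ℂ) ^ G.dist o x * f x := by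
  have : Countable V := countable_of_isTree hG.isTree
  rw [integral_countable hf]
  refine tsum_congr fun x => ?_
  rw [mu_real_singleton]
  simp

theorem summable_pow_dist [hG : IsHomogeneousTree G q] {α : ℝ} (hα : 1 < α) :
    Summable fun x => ((q : ℝ) ^ (-α)) ^ G.dist o x := by
  have := isFiniteMeasure_mu (G := G) (q := q) (o := o) hα
  have h := summable_of_integrable_mu (integrable_const (μ := mu G q o α) (1 : ℂ))
  simp only [mul_one] at h
  exact_mod_cast h

theorem exists_norm_explicitKernel_le [hG : IsHomogeneousTree G q] {β : ℝ} (hβ : 1 < β) (z : V) :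
    ∃ C : ℝ, ∀ x, ‖(explicitKernel G q o ((q : ℝ) ^ (-β)) z x : ℂ)‖ ≤ C := by
  have hr := rpow_neg_pos hG.two_le β
  obtain ⟨C, hC, h⟩ := exists_abs_explicitKernel_le (o := o) hr
    (mul_rpow_neg_lt_one hG.two_le hβ) (summable_pow_dist (G := G) hβ)
  refine ⟨C * ∑ i ∈ Finset.range (G.dist o z + 1),
    (((q : ℝ) ^ (-β)) ^ G.dist o ((parent G o)^[i] z))⁻¹, fun x => ?_⟩
  rw [Complex.norm_real, Real.norm_eq_abs]
  refine (h z x).trans (mul_le_mul_of_nonneg_left (Finset.sum_le_sum fun i _ =>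
    Set.indicator_le_self' (f := fun v => (((q : ℝ) ^ (-β)) ^ G.dist o v)⁻¹)
      (fun v _ => by positivity) ((parent G o)^[i] z)) hC.le)

omit [MeasurableSpace V] [DiscreteMeasurableSpace V] in
theorem isHarmonic_explicitKernel [hG : IsHomogeneousTree G q] (r : ℝ) (z : V) :
    IsHarmonic G q fun x => (explicitKernel G q o r z x : ℂ) := by
  refine isHarmonic_of_sum_neighbors fun x => ?_
  have h := sum_neighbors_explicitKernel (G := G) (q := q) (o := o) (r := r) z x
  exact_mod_cast congrArg (fun t : ℝ => (t : ℂ)) h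

theorem inner_Lp_mu [hG : IsHomogeneousTree G q] {α : ℝ} (f g : Lp ℂ 2 (mu G q o α)) :
    inner ℂ f g = ∑' x, (((q : ℝ) ^ (-α) : ℝ) : ℂ) ^ G.dist o x *
      (starRingEnd ℂ (f x) * g x) := by
  rw [L2.inner_def, integral_mu (L2.integrable_inner f g)]
  refine tsum_congr fun x => ?_
  rw [RCLike.inner_apply, mul_comm (g x)]

/-- The explicit kernel is bounded and harmonic in x, hence lies in the Bergman space because the
measure is finite. It reproduces values, and the representing vector is unique. -/
theorem kernel_eq [hG : IsHomogeneousTree G q] {β : ℝ} (hβ : 1 < β) (z x : V) :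
    kernel G q o β z x = explicitKernel G q o ((q : ℝ) ^ (-β)) z x := by
  have hfin := isFiniteMeasure_mu (G := G) (q := q) (o := o) hβ
  obtain ⟨C, hC⟩ := exists_norm_explicitKernel_le (G := G) (q := q) (o := o) hβ z
  have hmem : MemLp (fun x => (explicitKernel G q o ((q : ℝ) ^ (-β)) z x : ℂ)) 2 (mu G q o β) :=
    MemLp.of_bound (aestronglyMeasurable_mu β _) C (Filter.Eventually.of_forall hC)
  have hcoe : (hmem.toLp _ : V → ℂ) = fun x => (explicitKernel G q o ((q : ℝ) ^ (-β)) z x : ℂ) :=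
    eq_of_ae_eq G q o β hmem.coeFn_toLp
  have hharm : hmem.toLp _ ∈ bergman G q o 2 β := by
    change IsHarmonic G q (hmem.toLp _ : V → ℂ)
    rw [hcoe]
    exact isHarmonic_explicitKernel _ z
  have key : RKHS.kerFun (bergman G q o 2 β) z (1 : ℂ) = ⟨hmem.toLp _, hharm⟩ := by
    refine ext_inner_right ℂ fun g => ?_
    rw [RKHS.kerFun_inner, Submodule.coe_inner, inner_Lp_mu, hcoe]
    simp only [Complex.conj_ofReal]
    rw [tsum_explicitKernel_mul (rpow_neg_pos hG.two_le β) (mul_rpow_neg_lt_one hG.two_le hβ)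
      (show IsHarmonic G q (g : Lp ℂ 2 (mu G q o β)) from g.2)
      (summable_of_integrable_mu ((Lp.memLp (g : Lp ℂ 2 (mu G q o β))).integrable one_le_two))
      (summable_pow_dist hβ)]
    simp
    rfl
  rw [kernel, key]
  exact congrFun hcoe x

theorem kernelOperator_eq [hG : IsHomogeneousTree G q] {α β : ℝ} (hβ : 1 < β) (f : V → ℂ)
    (z : V) : kernelOperator G q o α β f z =
      ∑' x, (((q : ℝ) ^ (-β) : ℝ) : ℂ) ^ G.dist o x *
        (explicitKernel G q o ((q : ℝ) ^ (-β)) z x * f x) := by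
  have hq : (0 : ℝ) < q := by exact_mod_cast (by have := hG.two_le; omega : 0 < q)
  rw [kernelOperator]
  refine tsum_congr fun x => ?_
  have h : (q : ℝ) ^ ((α - β) * (G.dist o x : ℝ)) * (q : ℝ) ^ (-α * (G.dist o x : ℝ)) =
      ((q : ℝ) ^ (-β)) ^ G.dist o x := by
    rw [← Real.rpow_add hq, ← rpow_neg_mul_natCast]
    congr 1
    ring
  rw [kernel_eq hβ, mul_assoc, ← Complex.ofReal_mul, h]
  push_cast
  ring

/-- A reproducing kernel is Hermitian and this one is real. The symmetry is not visible in the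
formula; it provides harmonicity in the first variable. -/
theorem explicitKernel_comm [hG : IsHomogeneousTree G q] {β : ℝ} (hβ : 1 < β) (z x : V) :
    explicitKernel G q o ((q : ℝ) ^ (-β)) z x = explicitKernel G q o ((q : ℝ) ^ (-β)) x z := by
  let k : V → bergman G q o 2 β := fun z => RKHS.kerFun (bergman G q o 2 β) z (1 : ℂ)
  have h : ∀ z x, k z x = explicitKernel G q o ((q : ℝ) ^ (-β)) z x := kernel_eq hβ
  have h1 := inner_conj_symm (𝕜 := ℂ) (k x) (k z)
  have h2 := RKHS.kerFun_inner x (1 : ℂ) (k z)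
  have h3 := RKHS.kerFun_inner z (1 : ℂ) (k x)
  rw [RCLike.inner_apply, (starRingEnd ℂ).map_one, mul_one, h] at h2 h3
  rw [h2, h3, Complex.conj_ofReal] at h1
  exact_mod_cast h1.symm

/-- P f(z) = ⟨P f, K_z⟩ = ⟨f, K_z⟩, since K_z lies in the range of the projection. -/
theorem projector_eq_kernelOperator [hG : IsHomogeneousTree G q] {α : ℝ} (hα : 1 < α)
    {f : V → ℂ} (hf : MemLp f 2 (mu G q o α)) (z : V) :
    (projector G q o α (hf.toLp f) : Lp ℂ 2 (mu G q o α)) z = kernelOperator G q o α α f z := by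
  have h1 : inner ℂ (RKHS.kerFun (bergman G q o 2 α) z (1 : ℂ)) (projector G q o α (hf.toLp f)) =
      (projector G q o α (hf.toLp f) : Lp ℂ 2 (mu G q o α)) z := by
    rw [RKHS.kerFun_inner, RCLike.inner_apply, (starRingEnd ℂ).map_one, mul_one]
    rfl
  rw [← h1, projector, Submodule.inner_orthogonalProjectionOnto_eq_of_mem_left, inner_Lp_mu,
    kernelOperator_eq hα, eq_of_ae_eq G q o α hf.coeFn_toLp]
  refine tsum_congr fun x => ?_
  change _ * (starRingEnd ℂ (kernel G q o α z x) * f x) = _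
  rw [kernel_eq hα, Complex.conj_ofReal]

end Rooted

/-! ### The Schur test for the ancestor kernel. -/

theorem tsum_mul_rpow_le {ι : Type*} {p : ℝ} (hp : 1 ≤ p) (w f : ι → ℝ≥0∞) :
    (∑' i, w i * f i) ^ p ≤ (∑' i, w i) ^ (p - 1) * ∑' i, w i * f i ^ p := by
  have hp0 : 0 < p := by linarith
  have hinv : p⁻¹ ≤ 1 := inv_le_one_of_one_le₀ hp
  have h : ∑' i, w i * f i ≤ (∑' i, w i) ^ (1 - p⁻¹) * (∑' i, w i * f i ^ p) ^ p⁻¹ := by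
    rw [ENNReal.tsum_eq_iSup_sum]
    refine iSup_le fun s => (ENNReal.inner_le_weight_mul_Lp_of_nonneg s hp w f).trans ?_
    exact mul_le_mul' (ENNReal.rpow_le_rpow (ENNReal.sum_le_tsum s) (by linarith))
      (ENNReal.rpow_le_rpow (ENNReal.sum_le_tsum s) (by positivity))
  refine (ENNReal.rpow_le_rpow h hp0.le).trans_eq ?_
  rw [ENNReal.mul_rpow_of_nonneg _ _ hp0.le, ← ENNReal.rpow_mul, ← ENNReal.rpow_mul,
    inv_mul_cancel₀ hp0.ne', ENNReal.rpow_one, sub_mul, one_mul, inv_mul_cancel₀ hp0.ne']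

/-- These inequalities say that β - τ and α - τ(p - 1) both lie above 1, and that both stay below β:
the exponents for which the ancestor kernel can be summed. For p > 1 the critical requirement on θ =
τ(p - 1) is α - β < (β - 1)(p - 1), a rewriting of `h`. -/
theorem exists_schur_exponent {p α β : ℝ} (hp : 1 ≤ p) (hα : 1 < α) (hβ : 1 < β)
    (h : α - 1 < p * (β - 1)) :
    ∃ τ, 0 < τ ∧ τ < β - 1 ∧ α - β < τ * (p - 1) ∧ τ * (p - 1) < α - 1 := by
  rcases hp.eq_or_lt with rfl | hp1
  · exact ⟨(β - 1) / 2, by linarith, by linarith, by linarith, by linarith⟩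
  · have hp' : 0 < p - 1 := by linarith
    have h1 : max 0 (α - β) < min ((β - 1) * (p - 1)) (α - 1) := by
      have := mul_pos (sub_pos.2 hβ) hp'
      refine max_lt (lt_min this (by linarith)) (lt_min (by nlinarith) (by linarith))
    obtain ⟨θ, h2, h3⟩ := exists_between h1
    obtain ⟨h4, h5⟩ := max_lt_iff.1 h2
    obtain ⟨h6, h7⟩ := lt_min_iff.1 h3
    refine ⟨θ / (p - 1), div_pos h4 hp', (div_lt_iff₀ hp').2 h6, ?_, ?_⟩ <;>
      rw [div_mul_cancel₀ _ hp'.ne'] <;> assumption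

section Rooted

variable {V : Type*} {G : SimpleGraph V} {q : ℕ} {o : V}

/-- The sum of `q ^ (β |v|)` over the common ancestors `v` of `z` and `x`. -/
noncomputable def ancestorKernel (G : SimpleGraph V) (q : ℕ) (o : V) (β : ℝ) (z x : V) : ℝ≥0∞ :=
  ∑' v, {v | z ∈ sector G o v}.indicator
    ({v | x ∈ sector G o v}.indicator fun v => qpow q (β * G.dist o v)) v

theorem ancestorKernel_comm (β : ℝ) (z x : V) :
    ancestorKernel G q o β z x = ancestorKernel G q o β x z := by
  simp only [ancestorKernel, Set.indicator_indicator, Set.inter_comm]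

theorem ancestorKernel_eq (hG : G.IsTree) (β : ℝ) (z x : V) :
    ancestorKernel G q o β z x = ∑ i ∈ Finset.range (G.dist o z + 1),
      {v | x ∈ sector G o v}.indicator (fun v => qpow q (β * G.dist o v)) ((parent G o)^[i] z) :=
  tsum_ancestors hG z _

theorem tsum_ancestorKernel_mul (β : ℝ) (z : V) (u : V → ℝ≥0∞) :
    ∑' x, ancestorKernel G q o β z x * u x = ∑' v, {v | z ∈ sector G o v}.indicator
      (fun v => qpow q (β * G.dist o v) * ∑' x, (sector G o v).indicator u x) v := by
  simp only [ancestorKernel, ← ENNReal.tsum_mul_right]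
  rw [ENNReal.tsum_comm]
  refine tsum_congr fun v => ?_
  by_cases hz : z ∈ sector G o v
  · rw [Set.indicator_of_mem (by exact hz), ← ENNReal.tsum_mul_left]
    refine tsum_congr fun x => ?_
    rw [Set.indicator_of_mem (by exact hz)]
    by_cases hx : x ∈ sector G o v
    · rw [Set.indicator_of_mem (by exact hx), Set.indicator_of_mem hx]
    · rw [Set.indicator_of_notMem (by exact hx), Set.indicator_of_notMem hx, zero_mul, mul_zero]
  · rw [Set.indicator_of_notMem (by exact hz)]
    simp [Set.indicator_of_notMem (s := {v | z ∈ sector G o v}) hz]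

variable [G.LocallyFinite]

/-- Exchanging sums leaves a sum over the ancestors v of z. The sector of v contributes q^(-γ|v|) up
to a constant because γ > 1, and the remaining powers q^((β-γ)|v|) are dominated by v = z because γ
< β. -/
theorem exists_tsum_ancestorKernel_le [hG : IsHomogeneousTree G q] {β γ : ℝ} (h1 : 1 < γ)
    (h2 : γ < β) : ∃ C ≠ ∞, ∀ z, ∑' x, ancestorKernel G q o β z x * qpow q (-γ * G.dist o x) ≤
      C * qpow q ((β - γ) * G.dist o z) := by
  have hq := hG.two_le
  obtain ⟨C₁, hC₁, b₁⟩ := exists_tsum_sector_le (G := G) (q := q) (o := o) h1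
  obtain ⟨C₂, hC₂, b₂⟩ := exists_tsum_ancestors_le (o := o) hG.isTree hq (sub_pos.2 h2)
  refine ⟨C₁ * C₂, ENNReal.mul_ne_top hC₁ hC₂, fun z => ?_⟩
  rw [tsum_ancestorKernel_mul, mul_assoc]
  refine le_trans ?_ (mul_le_mul_right (b₂ z) C₁)
  rw [← ENNReal.tsum_mul_left]
  refine ENNReal.tsum_le_tsum fun v => ?_
  by_cases hz : z ∈ sector G o v
  · rw [Set.indicator_of_mem (by exact hz), Set.indicator_of_mem (by exact hz)]
    refine (mul_le_mul_right (b₁ v) _).trans_eq ?_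
    rw [mul_left_comm, ← qpow_add hq]
    congr 2
    ring
  · rw [Set.indicator_of_notMem (by exact hz)]
    exact zero_le

theorem exists_schur_bound [hG : IsHomogeneousTree G q] {p α β : ℝ} (hp : 1 ≤ p) (hα : 1 < α)
    (hβ : 1 < β) (h : α - 1 < p * (β - 1)) :
    ∃ C ≠ ∞, ∀ F : V → ℝ≥0∞,
      ∑' z, (∑' x, ancestorKernel G q o β z x * (qpow q (-β * G.dist o x) * F x)) ^ p *
        qpow q (-α * G.dist o z) ≤ C * ∑' x, F x ^ p * qpow q (-α * G.dist o x) := by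
  have hq := hG.two_le
  have hp0 : 0 ≤ p := by linarith
  obtain ⟨τ, t1, t2, t3, t4⟩ := exists_schur_exponent hp hα hβ h
  obtain ⟨C₁, hC₁, b₁⟩ := exists_tsum_ancestorKernel_le (G := G) (q := q) (o := o) (β := β)
    (γ := β - τ) (by linarith) (by linarith)
  obtain ⟨C₂, hC₂, b₂⟩ := exists_tsum_ancestorKernel_le (G := G) (q := q) (o := o) (β := β)
    (γ := α - τ * (p - 1)) (by linarith) (by linarith)
  refine ⟨C₁ ^ (p - 1) * C₂, ENNReal.mul_ne_top
    (ENNReal.rpow_ne_top_of_nonneg (by linarith) hC₁) hC₂, fun F => ?_⟩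
  have s1 : ∀ z, (∑' x, ancestorKernel G q o β z x * (qpow q (-β * G.dist o x) * F x)) ^ p *
      qpow q (-α * G.dist o z) ≤ C₁ ^ (p - 1) * ∑' x, (ancestorKernel G q o β x z *
        qpow q (-(α - τ * (p - 1)) * G.dist o z)) *
        (qpow q ((τ - β - τ * p) * G.dist o x) * F x ^ p) := by
    intro z
    -- The weight q^(-β|x|) is split so that the first part can be summed against the kernel, while
    -- q^(-τ|x|) stays with F when Jensen's inequality is applied.
    have e1 : ∀ x, ancestorKernel G q o β z x * (qpow q (-β * G.dist o x) * F x) =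
        (ancestorKernel G q o β z x * qpow q (-(β - τ) * G.dist o x)) *
          (qpow q (-τ * G.dist o x) * F x) := by
      intro x
      rw [mul_assoc, ← mul_assoc (qpow q _) (qpow q _), ← qpow_add hq]
      congr 3
      ring
    rw [tsum_congr e1]
    calc _ ≤ ((C₁ * qpow q (τ * G.dist o z)) ^ (p - 1) *
          ∑' x, ancestorKernel G q o β z x * qpow q (-(β - τ) * G.dist o x) *
            (qpow q (-τ * G.dist o x) * F x) ^ p) * qpow q (-α * G.dist o z) := by
          refine mul_le_mul_left ((tsum_mul_rpow_le hp _ _).trans (mul_le_mul_left ?_ _)) _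
          refine ENNReal.rpow_le_rpow ((b₁ z).trans_eq ?_) (by linarith)
          rw [sub_sub_cancel]
      _ = C₁ ^ (p - 1) * ∑' x, qpow q (-(α - τ * (p - 1)) * G.dist o z) *
            (ancestorKernel G q o β z x * qpow q (-(β - τ) * G.dist o x) *
            (qpow q (-τ * G.dist o x) * F x) ^ p) := by
          have : qpow q (-(α - τ * (p - 1)) * G.dist o z) =
              qpow q (τ * G.dist o z) ^ (p - 1) * qpow q (-α * G.dist o z) := by
            rw [qpow_rpow hq, ← qpow_add hq]
            congr 1
            ring
          rw [ENNReal.mul_rpow_of_nonneg _ _ (by linarith), ENNReal.tsum_mul_left, this]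
          ring
      _ = _ := by
          congr 1
          refine tsum_congr fun x => ?_
          have : qpow q ((τ - β - τ * p) * G.dist o x) =
              qpow q (-(β - τ) * G.dist o x) * qpow q (-τ * G.dist o x) ^ p := by
            rw [qpow_rpow hq, ← qpow_add hq]
            congr 1
            ring
          rw [ENNReal.mul_rpow_of_nonneg _ _ hp0, this, ancestorKernel_comm β z x]
          ring
  refine (ENNReal.tsum_le_tsum s1).trans ?_
  -- After the exchange the kernel is summed over z with exponent α - τ(p - 1); the powers of q then
  -- recombine to q^(-α|x|).
  rw [ENNReal.tsum_mul_left, ENNReal.tsum_comm, mul_assoc, ← ENNReal.tsum_mul_left (a := C₂)]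
  refine mul_le_mul_right (ENNReal.tsum_le_tsum fun x => ?_) _
  rw [ENNReal.tsum_mul_right]
  refine (mul_le_mul_left (b₂ x) _).trans_eq ?_
  have : qpow q (-α * G.dist o x) = qpow q ((β - (α - τ * (p - 1))) * G.dist o x) *
      qpow q ((τ - β - τ * p) * G.dist o x) := by
    rw [← qpow_add hq]
    congr 1
    ring
  rw [this]
  ring

/-! ### Sufficiency: boundedness of the operator. -/

variable [MeasurableSpace V] [DiscreteMeasurableSpace V]

theorem exists_enorm_explicitKernel_le [hG : IsHomogeneousTree G q] {β : ℝ} (hβ : 1 < β) :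
    ∃ C ≠ ∞, ∀ z x, ‖(explicitKernel G q o ((q : ℝ) ^ (-β)) z x : ℂ)‖ₑ ≤
      C * ancestorKernel G q o β z x := by
  have hr := rpow_neg_pos hG.two_le β
  obtain ⟨C, hC, h⟩ := exists_abs_explicitKernel_le (o := o) hr
    (mul_rpow_neg_lt_one hG.two_le hβ) (summable_pow_dist (G := G) hβ)
  refine ⟨ENNReal.ofReal C, ENNReal.ofReal_ne_top, fun z x => ?_⟩
  rw [← ofReal_norm, Complex.norm_real, Real.norm_eq_abs]
  refine (ENNReal.ofReal_le_ofReal (h z x)).trans_eq ?_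
  have hnn : ∀ v, 0 ≤ {v | x ∈ sector G o v}.indicator
      (fun v => (((q : ℝ) ^ (-β)) ^ G.dist o v)⁻¹) v :=
    fun v => Set.indicator_nonneg (fun _ _ => by positivity) v
  rw [ENNReal.ofReal_mul hC.le, ENNReal.ofReal_sum_of_nonneg fun i _ => hnn _,
    ancestorKernel_eq hG.isTree]
  congr 1
  refine Finset.sum_congr rfl fun i _ => ?_
  by_cases hx : x ∈ sector G o ((parent G o)^[i] z)
  · rw [Set.indicator_of_mem (by exact hx), Set.indicator_of_mem (by exact hx), qpow,
      ← rpow_neg_mul_natCast, ← Real.rpow_neg (Nat.cast_nonneg q), ← neg_mul, neg_neg]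
  · rw [Set.indicator_of_notMem (by exact hx), Set.indicator_of_notMem (by exact hx),
      ENNReal.ofReal_zero]

omit [G.LocallyFinite] in
theorem eLpNorm_mu_rpow {p : ℝ≥0∞} (hp1 : 1 ≤ p) (hp : p ≠ ∞) (α : ℝ) (f : V → ℂ) :
    eLpNorm f p (mu G q o α) ^ p.toReal =
      ∑' x, ‖f x‖ₑ ^ p.toReal * qpow q (-α * G.dist o x) := by
  have hp0 : p ≠ 0 := (zero_lt_one.trans_le hp1).ne'
  have : p.toReal ≠ 0 := (ENNReal.toReal_pos hp0 hp).ne'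
  rw [eLpNorm_eq_lintegral_rpow_enorm_toReal hp0 hp, lintegral_mu, ← ENNReal.rpow_mul,
    one_div, inv_mul_cancel₀ this, ENNReal.rpow_one]

theorem exists_kernelOperator_bound [hG : IsHomogeneousTree G q] {p : ℝ≥0∞} (hp1 : 1 ≤ p)
    (hp : p ≠ ∞) {α β : ℝ} (hα : 1 < α) (hβ : 1 < β) (h : α - 1 < p.toReal * (β - 1)) :
    ∃ C ≠ ∞, ∀ f : V → ℂ, MemLp f p (mu G q o α) →
      (∀ z, Summable fun x => (((q : ℝ) ^ (-β) : ℝ) : ℂ) ^ G.dist o x *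
        (explicitKernel G q o ((q : ℝ) ^ (-β)) z x * f x)) ∧
      eLpNorm (kernelOperator G q o α β f) p (mu G q o α) ≤ C * eLpNorm f p (mu G q o α) := by
  have hq := hG.two_le
  have hp0 : p ≠ 0 := (zero_lt_one.trans_le hp1).ne'
  have hpr : 1 ≤ p.toReal := by
    rw [← ENNReal.toReal_one]
    exact ENNReal.toReal_mono hp hp1
  have hpr0 : 0 < p.toReal := by linarith
  obtain ⟨C₁, hC₁, b₁⟩ := exists_enorm_explicitKernel_le (G := G) (q := q) (o := o) hβ
  obtain ⟨C₂, hC₂, b₂⟩ := exists_schur_bound (G := G) (q := q) (o := o) hpr hα hβ h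
  refine ⟨C₁ * C₂ ^ p.toReal⁻¹, ENNReal.mul_ne_top hC₁
    (ENNReal.rpow_ne_top_of_nonneg (by positivity) hC₂), fun f hf => ?_⟩
  set S : V → ℝ≥0∞ := fun z =>
    ∑' x, ancestorKernel G q o β z x * (qpow q (-β * G.dist o x) * ‖f x‖ₑ) with hS
  have hterm : ∀ z x, ‖(((q : ℝ) ^ (-β) : ℝ) : ℂ) ^ G.dist o x *
        (explicitKernel G q o ((q : ℝ) ^ (-β)) z x * f x)‖ₑ ≤
      C₁ * (ancestorKernel G q o β z x * (qpow q (-β * G.dist o x) * ‖f x‖ₑ)) := by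
    intro z x
    have hr : ‖(((q : ℝ) ^ (-β) : ℝ) : ℂ) ^ G.dist o x‖ₑ = qpow q (-β * G.dist o x) := by
      rw [← ofReal_norm, norm_pow, Complex.norm_real, Real.norm_of_nonneg (rpow_neg_pos hq β).le,
        ← rpow_neg_mul_natCast, qpow]
    rw [enorm_mul, enorm_mul, hr]
    calc _ ≤ qpow q (-β * G.dist o x) * (C₁ * ancestorKernel G q o β z x * ‖f x‖ₑ) := by
          gcongr; exact b₁ z x
      _ = _ := by ring
  have hfin : eLpNorm f p (mu G q o α) ^ p.toReal ≠ ∞ :=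
    ENNReal.rpow_ne_top_of_nonneg hpr0.le hf.2.ne
  have hb := b₂ fun x => ‖f x‖ₑ
  rw [← eLpNorm_mu_rpow hp1 hp] at hb
  -- Every vertex has positive mass, so the norm bound already forces pointwise finiteness, and with
  -- it absolute convergence of the defining series.
  have hSz : ∀ z, S z ≠ ∞ := by
    intro z hz
    have h1 := (ENNReal.le_tsum z).trans hb
    change S z ^ p.toReal * _ ≤ _ at h1
    rw [hz, ENNReal.top_rpow_of_pos hpr0, ENNReal.top_mul (qpow_ne_zero hq _)] at h1
    exact ENNReal.mul_ne_top hC₂ hfin (top_le_iff.1 h1)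
  have hsum : ∀ z, ∑' x, ‖(((q : ℝ) ^ (-β) : ℝ) : ℂ) ^ G.dist o x *
        (explicitKernel G q o ((q : ℝ) ^ (-β)) z x * f x)‖ₑ ≤ C₁ * S z := by
    intro z
    rw [hS, ← ENNReal.tsum_mul_left]
    exact ENNReal.tsum_le_tsum (hterm z)
  have hsm : ∀ z, Summable fun x => (((q : ℝ) ^ (-β) : ℝ) : ℂ) ^ G.dist o x *
        (explicitKernel G q o ((q : ℝ) ^ (-β)) z x * f x) := fun z =>
    Summable.of_enorm ((hsum z).trans_lt (ENNReal.mul_lt_top hC₁.lt_top (hSz z).lt_top)).ne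
  refine ⟨hsm, ?_⟩
  rw [← ENNReal.rpow_le_rpow_iff hpr0, eLpNorm_mu_rpow hp1 hp,
    ENNReal.mul_rpow_of_nonneg _ _ hpr0.le, ENNReal.mul_rpow_of_nonneg _ _ hpr0.le,
    ← ENNReal.rpow_mul, inv_mul_cancel₀ hpr0.ne', ENNReal.rpow_one, mul_assoc]
  refine le_trans ?_ (mul_le_mul_right hb _)
  rw [← ENNReal.tsum_mul_left]
  refine ENNReal.tsum_le_tsum fun z => ?_
  rw [← mul_assoc, ← ENNReal.mul_rpow_of_nonneg _ _ hpr0.le]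
  gcongr
  rw [kernelOperator_eq hβ]
  exact (enorm_tsum_le_tsum_enorm (f := fun x => (((q : ℝ) ^ (-β) : ℝ) : ℂ) ^ G.dist o x *
        (explicitKernel G q o ((q : ℝ) ^ (-β)) z x * f x))).trans (hsum z)

theorem isHarmonic_kernelOperator [hG : IsHomogeneousTree G q] {α β : ℝ} (hβ : 1 < β) {f : V → ℂ}
    (hf : ∀ z, Summable fun x => (((q : ℝ) ^ (-β) : ℝ) : ℂ) ^ G.dist o x *
        (explicitKernel G q o ((q : ℝ) ^ (-β)) z x * f x)) :
    IsHarmonic G q (kernelOperator G q o α β f) := by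
  refine isHarmonic_of_sum_neighbors fun z => ?_
  simp only [kernelOperator_eq hβ]
  rw [← Summable.tsum_finsetSum fun u _ => hf u, ← tsum_mul_left]
  refine tsum_congr fun x => ?_
  rw [← Finset.mul_sum, ← Finset.sum_mul]
  have h := (isHarmonic_explicitKernel (G := G) (q := q) (o := o) ((q : ℝ) ^ (-β))
    x).sum_neighbors z
  simp only [explicitKernel_comm hβ _ x]
  rw [h]
  ring

/-- No density argument is needed: the series converges absolutely for every f in L^p_α and itself
defines the extension. -/
theorem exists_extension_of_lt [hG : IsHomogeneousTree G q] {p : ℝ≥0∞} [Fact (1 ≤ p)]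
    (hp : p ≠ ∞) {α β : ℝ} (hα : 1 < α) (hβ : 1 < β) (h : α - 1 < p.toReal * (β - 1)) :
    ∃ T : Lp ℂ p (mu G q o α) →L[ℂ] bergman G q o p α,
      ∀ (f : V → ℂ) (hf : MemLp f p (mu G q o α)) (z : V),
        (T (hf.toLp f) : Lp ℂ p (mu G q o α)) z = kernelOperator G q o α β f z := by
  obtain ⟨C, hC, b⟩ := exists_kernelOperator_bound (G := G) (q := q) (o := o) Fact.out hp hα hβ h
  have hmem : ∀ f : Lp ℂ p (mu G q o α),
      MemLp (kernelOperator G q o α β f) p (mu G q o α) := fun f =>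
    ⟨aestronglyMeasurable_mu α _, ((b f (Lp.memLp f)).2).trans_lt
      (ENNReal.mul_lt_top hC.lt_top (Lp.memLp f).2)⟩
  have hcoe : ∀ f, ((hmem f).toLp _ : V → ℂ) = kernelOperator G q o α β f := fun f =>
    eq_of_ae_eq G q o α (hmem f).coeFn_toLp
  have hharm : ∀ f, (hmem f).toLp _ ∈ bergman G q o p α := by
    intro f
    change IsHarmonic G q ((hmem f).toLp _ : V → ℂ)
    rw [hcoe]
    exact isHarmonic_kernelOperator hβ (b f (Lp.memLp f)).1
  let L : Lp ℂ p (mu G q o α) →ₗ[ℂ] bergman G q o p α :=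
    { toFun := fun f => ⟨(hmem f).toLp _, hharm f⟩
      map_add' := by
        intro f g
        refine Subtype.ext (Lp.ext (Filter.EventuallyEq.of_eq ?_))
        refine (hcoe (f + g)).trans
          (Eq.trans ?_ (eq_of_ae_eq G q o α (Lp.coeFn_add _ _)).symm)
        change _ = ((hmem f).toLp _ : V → ℂ) + ((hmem g).toLp _ : V → ℂ)
        rw [hcoe, hcoe, eq_of_ae_eq G q o α (Lp.coeFn_add f g)]
        funext z
        rw [Pi.add_apply, kernelOperator_eq hβ, kernelOperator_eq hβ, kernelOperator_eq hβ,
          ← ((b f (Lp.memLp f)).1 z).tsum_add ((b g (Lp.memLp g)).1 z)]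
        refine tsum_congr fun x => ?_
        rw [Pi.add_apply]
        ring
      map_smul' := by
        intro c f
        refine Subtype.ext (Lp.ext (Filter.EventuallyEq.of_eq ?_))
        refine (hcoe (c • f)).trans
          (Eq.trans ?_ (eq_of_ae_eq G q o α (Lp.coeFn_smul _ _)).symm)
        change _ = c • ((hmem f).toLp _ : V → ℂ)
        rw [hcoe, eq_of_ae_eq G q o α (Lp.coeFn_smul c f)]
        funext z
        rw [Pi.smul_apply, kernelOperator_eq hβ, kernelOperator_eq hβ, smul_eq_mul,
          ← tsum_mul_left]
        refine tsum_congr fun x => ?_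
        rw [Pi.smul_apply, smul_eq_mul]
        ring }
  refine ⟨L.mkContinuous C.toReal fun f => ?_, fun f hf z => ?_⟩
  · change ‖(hmem f).toLp _‖ ≤ _
    rw [Lp.norm_toLp, Lp.norm_def, ← ENNReal.toReal_mul]
    exact ENNReal.toReal_mono (ENNReal.mul_ne_top hC (Lp.memLp f).2.ne) (b f (Lp.memLp f)).2
  · change ((hmem (hf.toLp f)).toLp _ : V → ℂ) z = _
    rw [hcoe, eq_of_ae_eq G q o α hf.coeFn_toLp]

end Rooted

/-! ### Necessity: test functions. -/

section Rooted

variable {V : Type*} {G : SimpleGraph V} {q : ℕ} {o : V}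

theorem sectorWave_sibling_of_dist_ne (hG : G.IsTree) {y s c : V} (hy : y ≠ o) (hs : s ≠ o)
    (hys : parent G o y = parent G o s) (hc : G.dist o c ≠ G.dist o y) :
    sectorWave G q o c y = sectorWave G q o c s := by
  have hd : G.dist o y = G.dist o s := by
    rw [← dist_parent_add_one hG hy, ← dist_parent_add_one hG hs, hys]
  have hcy : y ≠ c := by rintro rfl; exact hc rfl
  have hcs : s ≠ c := by rintro rfl; exact hc hd.symm
  have h : y ∈ sector G o c ↔ s ∈ sector G o c := by
    rw [← parent_mem_sector_iff hG hcy, hys, parent_mem_sector_iff hG hcs]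
  by_cases hm : y ∈ sector G o c
  · rw [sectorWave_of_mem hm, sectorWave_of_mem (h.1 hm), hd]
  · rw [sectorWave_of_notMem hm, sectorWave_of_notMem fun h' => hm (h.2 h')]

open Classical in
theorem sectorWave_of_dist_eq {c y : V} (hc : G.dist o c = G.dist o y) :
    sectorWave G q o c y = if c = y then 1 else 0 := by
  split_ifs with h
  · subst h
    rw [sectorWave_of_mem (self_mem_sector c), Nat.sub_self, zero_add, geomCoef_one]
  · refine sectorWave_of_notMem fun hm => h ?_
    rw [mem_sector_iff, hc, Nat.sub_self] at hm
    exact hm.symm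

variable [G.LocallyFinite]

theorem sectorHarmonic_sibling_of_dist_ne (hG : G.IsTree) {y s c : V} (hy : y ≠ o) (hs : s ≠ o)
    (hco : c ≠ o) (hys : parent G o y = parent G o s) (hc : G.dist o c ≠ G.dist o y) :
    sectorHarmonic G q o c y = sectorHarmonic G q o c s := by
  rw [sectorHarmonic, sectorHarmonic, sectorWave_sibling_of_dist_ne hG hy hs hys hc]
  congr 2
  refine Finset.sum_congr rfl fun c' hc' => sectorWave_sibling_of_dist_ne hG hy hs hys ?_
  rwa [dist_of_mem_children hG hc', dist_parent_add_one hG hco]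

theorem sectorHarmonic_self_sub_sibling (hG : G.IsTree) {y s : V} (hy : y ≠ o) (hs : s ≠ o)
    (hne : y ≠ s) (hys : parent G o y = parent G o s) :
    sectorHarmonic G q o y y - sectorHarmonic G q o y s = 1 := by
  classical
  have hd : G.dist o y = G.dist o s := by
    rw [← dist_parent_add_one hG hy, ← dist_parent_add_one hG hs, hys]
  have hsum : ∀ t, t ≠ o → parent G o t = parent G o y →
      ∑ c ∈ children G o (parent G o y), sectorWave G q o c t = 1 := by
    intro t ht hty
    have h : ∀ c ∈ children G o (parent G o y), sectorWave G q o c t = if c = t then 1 else 0 := by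
      intro c hc
      refine sectorWave_of_dist_eq ?_
      rw [dist_of_mem_children hG hc, ← hty, dist_parent_add_one hG ht]
    rw [Finset.sum_congr rfl h, Finset.sum_ite_eq', if_pos ((mem_children hG).2 ⟨ht, hty⟩)]
  rw [sectorHarmonic, sectorHarmonic, hsum y hy rfl, hsum s hs hys.symm,
    sectorWave_of_dist_eq rfl, sectorWave_of_dist_eq hd, if_pos rfl, if_neg hne]
  ring

/-- Only the i-th summand distinguishes the i-th ancestor of x from its sibling: waves starting on
another sphere agree at the two vertices. -/
theorem explicitKernel_sub_sibling (hG : G.IsTree) {r : ℝ} {x s : V} {i : ℕ}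
    (hi : i < G.dist o x) (hs : s ≠ o) (hne : (parent G o)^[i] x ≠ s)
    (hys : parent G o ((parent G o)^[i] x) = parent G o s) :
    explicitKernel G q o r x ((parent G o)^[i] x) - explicitKernel G q o r x s =
      (profileNormSq q r)⁻¹ * ((r ^ (G.dist o s - 1))⁻¹ * geomCoef q (i + 1)) := by
  have hy := iterate_parent_ne_root hG hi
  rw [explicitKernel, explicitKernel, add_sub_add_left_eq_sub, ← mul_sub,
    ← Finset.sum_sub_distrib, Finset.sum_eq_single i]
  · rw [← mul_sub, sectorHarmonic_self_sub_sibling hG hy hs hne hys, hys, dist_parent hG, mul_one]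
  · intro l hl hli
    have hl' := Finset.mem_range.1 hl
    rw [sectorHarmonic_sibling_of_dist_ne hG hy hs (iterate_parent_ne_root hG hl') hys, sub_self]
    rw [dist_iterate_parent hG, dist_iterate_parent hG]
    omega
  · intro h
    exact absurd (Finset.mem_range.2 hi) h

theorem exists_sibling [hG : IsHomogeneousTree G q] (y : V) :
    ∃ s, s ≠ o ∧ y ≠ s ∧ parent G o y = parent G o s := by
  have hT := hG.isTree
  have hq := hG.two_le
  have h : 1 < (children G o (parent G o y)).card := by
    by_cases h : parent G o y = o
    · rw [h, card_children_root (q := q)]; omega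
    · rw [card_children_of_ne_root (q := q) h]; omega
  obtain ⟨s, hs, hsy⟩ := Finset.exists_mem_ne h y
  obtain ⟨h1, h2⟩ := (mem_children hT).1 hs
  exact ⟨s, h1, hsy.symm, h2.symm⟩

variable [MeasurableSpace V] [DiscreteMeasurableSpace V]

/-- Both measures are finite, so bounded functions are admissible test functions. -/
theorem exists_bound_of_extension [hG : IsHomogeneousTree G q] {p : ℝ≥0∞} [Fact (1 ≤ p)]
    (hp : p ≠ ∞) {α β : ℝ} (hα : 1 < α) (hβ : 1 < β)
    (T : Lp ℂ p (mu G q o α) →L[ℂ] Lp ℂ p (mu G q o α))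
    (hT : ∀ (f : V → ℂ) (hf : MemLp f p (mu G q o α)), MemLp f 2 (mu G q o β) →
      ∀ z, T (hf.toLp f) z = kernelOperator G q o α β f z) :
    ∃ C ≠ ∞, ∀ (f : V → ℂ) (R : ℝ), (∀ x, ‖f x‖ ≤ R) →
      ∑' z, ‖kernelOperator G q o α β f z‖ₑ ^ p.toReal * qpow q (-α * G.dist o z) ≤
        C * ∑' x, ‖f x‖ₑ ^ p.toReal * qpow q (-α * G.dist o x) := by
  have hp1 : 1 ≤ p := Fact.out
  have := isFiniteMeasure_mu (G := G) (q := q) (o := o) hα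
  have := isFiniteMeasure_mu (G := G) (q := q) (o := o) hβ
  refine ⟨‖T‖ₑ ^ p.toReal, ENNReal.rpow_ne_top_of_nonneg ENNReal.toReal_nonneg enorm_ne_top,
    fun f R hR => ?_⟩
  have hf : MemLp f p (mu G q o α) :=
    MemLp.of_bound (aestronglyMeasurable_mu α f) R (Filter.Eventually.of_forall hR)
  have hf2 : MemLp f 2 (mu G q o β) :=
    MemLp.of_bound (aestronglyMeasurable_mu β f) R (Filter.Eventually.of_forall hR)
  have h := T.le_opENorm (hf.toLp f)
  rw [Lp.enorm_def, Lp.enorm_def, eq_of_ae_eq G q o α hf.coeFn_toLp,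
    show (T (hf.toLp f) : V → ℂ) = kernelOperator G q o α β f from funext (hT f hf hf2)] at h
  have h' := ENNReal.rpow_le_rpow h (ENNReal.toReal_nonneg (a := p))
  rwa [ENNReal.mul_rpow_of_nonneg _ _ ENNReal.toReal_nonneg, eLpNorm_mu_rpow hp1 hp,
    eLpNorm_mu_rpow hp1 hp] at h'

theorem enorm_kernelOperator_root [hG : IsHomogeneousTree G q] {α β : ℝ} (hβ : 1 < β) {f : V → ℝ}
    (hf : ∀ x, 0 ≤ f x) {R : ℝ} (hR : ∀ x, f x ≤ R) :
    ‖kernelOperator G q o α β (fun x => (f x : ℂ)) o‖ₑ =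
      ENNReal.ofReal (∑' x, ((q : ℝ) ^ (-β)) ^ G.dist o x)⁻¹ *
        ∑' x, qpow q (-β * G.dist o x) * ENNReal.ofReal (f x) := by
  have hr := rpow_neg_pos hG.two_le β
  have hs := summable_pow_dist (G := G) (q := q) (o := o) hβ
  have hs' : Summable fun x => ((q : ℝ) ^ (-β)) ^ G.dist o x * f x := by
    refine (hs.mul_right R).of_nonneg_of_le (fun x => mul_nonneg (by positivity) (hf x)) fun x => ?_
    exact mul_le_mul_of_nonneg_left (hR x) (by positivity)
  have h0 : ∀ x, 0 ≤ ((q : ℝ) ^ (-β)) ^ G.dist o x * f x :=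
    fun x => mul_nonneg (by positivity) (hf x)
  have hM : 0 ≤ (∑' x, ((q : ℝ) ^ (-β)) ^ G.dist o x)⁻¹ :=
    inv_nonneg.2 (tsum_nonneg fun x => by positivity)
  have e : kernelOperator G q o α β (fun x => (f x : ℂ)) o =
      ((∑' x, ((q : ℝ) ^ (-β)) ^ G.dist o x)⁻¹ *
        ∑' x, ((q : ℝ) ^ (-β)) ^ G.dist o x * f x : ℝ) := by
    rw [kernelOperator_eq hβ, ← tsum_mul_left, Complex.ofReal_tsum]
    refine tsum_congr fun x => ?_
    rw [explicitKernel_root]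
    push_cast
    ring
  rw [e, ← ofReal_norm, Complex.norm_real, Real.norm_of_nonneg (mul_nonneg hM (tsum_nonneg h0)),
    ENNReal.ofReal_mul hM, ENNReal.ofReal_tsum_of_nonneg h0 hs']
  congr 1
  refine tsum_congr fun x => ?_
  rw [ENNReal.ofReal_mul (by positivity), ← rpow_neg_mul_natCast, qpow]

omit [MeasurableSpace V] [DiscreteMeasurableSpace V] in
theorem tsum_radial (hG : G.IsTree) (u : ℕ → ℝ≥0∞) :
    ∑' x, u (G.dist o x) = ∑' k : ℕ, ((descendants G o k o).card : ℝ≥0∞) * u k := by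
  have h := tsum_sector_ennreal (o := o) hG o fun x => u (G.dist o x)
  rw [sector_root hG, Set.indicator_univ] at h
  rw [h]
  refine tsum_congr fun k => ?_
  rw [Finset.sum_congr rfl fun x hx => by
    rw [((mem_descendants hG).1 hx).1, SimpleGraph.dist_self, zero_add], Finset.sum_const,
    nsmul_eq_mul]

theorem lt_of_extension_of_one_lt [hG : IsHomogeneousTree G q] {p : ℝ≥0∞} [Fact (1 ≤ p)]
    (hp : p ≠ ∞) (hp1 : 1 < p.toReal) {α β : ℝ} (hα : 1 < α) (hβ : 1 < β)
    (T : Lp ℂ p (mu G q o α) →L[ℂ] Lp ℂ p (mu G q o α))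
    (hT : ∀ (f : V → ℂ) (hf : MemLp f p (mu G q o α)), MemLp f 2 (mu G q o β) →
      ∀ z, T (hf.toLp f) z = kernelOperator G q o α β f z) :
    α - 1 < p.toReal * (β - 1) := by
  by_contra! hle
  have hq := hG.two_le
  have hq1 : (1 : ℝ) ≤ q := by exact_mod_cast (by omega : 1 ≤ q)
  obtain ⟨C, hC, hb⟩ := exists_bound_of_extension hp hα hβ T hT
  set P := p.toReal with hP
  have hP0 : 0 < P := by linarith
  -- The critical exponent: each sphere contributes a bounded amount to the p-th power of the L^p_α
  -- norm of q^(s|x|), while β - 1 ≤ s keeps its contribution to the μ_β-integral at least 1.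
  set s : ℝ := (α - 1) / P with hs
  have hs0 : 0 < s := div_pos (by linarith) hP0
  have hsP : s * P = α - 1 := div_mul_cancel₀ _ hP0.ne'
  have hsβ : β - 1 ≤ s := by
    rw [hs, le_div_iff₀ hP0]; linarith
  set M : ℝ≥0∞ := ENNReal.ofReal (∑' x, ((q : ℝ) ^ (-β)) ^ G.dist o x)⁻¹ with hM
  have hr := rpow_neg_pos hq β
  have hM0 : M ≠ 0 := by
    rw [hM]
    exact (ENNReal.ofReal_pos.2 (inv_pos.2 ((summable_pow_dist hβ).tsum_pos
      (fun x => by positivity) o (by positivity)))).ne'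
  have key : ∀ N : ℕ, (M * N) ^ P ≤ C * (2 * N) := by
    intro N
    set f : V → ℝ := fun x => if G.dist o x < N then (q : ℝ) ^ (s * G.dist o x) else 0 with hf
    have hf0 : ∀ x, 0 ≤ f x := by
      intro x
      rw [hf]
      positivity
    have hfR : ∀ x, f x ≤ (q : ℝ) ^ (s * N) := by
      intro x
      rw [hf]
      simp only
      split_ifs with h
      · exact Real.rpow_le_rpow_of_exponent_le hq1 (by gcongr)
      · positivity
    have hfe : ∀ x, ENNReal.ofReal (f x) =
        if G.dist o x < N then qpow q (s * G.dist o x) else 0 := by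
      intro x
      rw [hf]
      simp only
      split_ifs
      · rfl
      · exact ENNReal.ofReal_zero
    have hfn : ∀ x, ‖(f x : ℂ)‖ₑ = ENNReal.ofReal (f x) := by
      intro x
      rw [← ofReal_norm, Complex.norm_real, Real.norm_of_nonneg (hf0 x)]
    have h := hb (fun x => (f x : ℂ)) ((q : ℝ) ^ (s * N)) fun x => by
      rw [Complex.norm_real, Real.norm_of_nonneg (hf0 x)]; exact hfR x
    have h1 := (ENNReal.le_tsum o).trans h
    rw [enorm_kernelOperator_root hβ hf0 hfR, SimpleGraph.dist_self, Nat.cast_zero, mul_zero,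
      qpow_zero, mul_one] at h1
    simp only [hfn, hfe] at h1
    have hlow : (N : ℝ≥0∞) ≤ ∑' x, qpow q (-β * G.dist o x) *
        (if G.dist o x < N then qpow q (s * G.dist o x) else 0) := by
      rw [tsum_radial hG.isTree fun k => qpow q (-β * k) * (if k < N then qpow q (s * k) else 0)]
      refine le_trans ?_ (ENNReal.sum_le_tsum (Finset.range N))
      have : (N : ℝ≥0∞) = ∑ k ∈ Finset.range N, 1 := by simp
      rw [this]
      refine Finset.sum_le_sum fun k hk => ?_
      rw [if_pos (Finset.mem_range.1 hk), ← qpow_add hq]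
      have hcard : qpow q k ≤ ((descendants G o k o).card : ℝ≥0∞) := by
        rw [qpow_natCast]
        exact_mod_cast le_card_descendants q k o
      refine le_trans ?_ (mul_le_mul_left hcard _)
      rw [← qpow_add hq, ← qpow_zero q]
      refine qpow_mono hq ?_
      have : 0 ≤ (k : ℝ) * (s - (β - 1)) := mul_nonneg (by positivity) (by linarith)
      linarith
    have hup : ∑' x, (if G.dist o x < N then qpow q (s * G.dist o x) else 0) ^ P *
        qpow q (-α * G.dist o x) ≤ 2 * N := by
      rw [tsum_radial hG.isTree fun k => (if k < N then qpow q (s * k) else 0) ^ P *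
        qpow q (-α * k), tsum_eq_sum (s := Finset.range N)]
      · have : (2 * N : ℝ≥0∞) = ∑ k ∈ Finset.range N, 2 := by simp [mul_comm]
        rw [this]
        refine Finset.sum_le_sum fun k hk => ?_
        rw [if_pos (Finset.mem_range.1 hk), qpow_rpow hq, ← qpow_add hq]
        have hcard : ((descendants G o k o).card : ℝ≥0∞) ≤ 2 * qpow q k := by
          rw [qpow_natCast]
          exact_mod_cast card_descendants_le q k o
        refine (mul_le_mul_left hcard _).trans_eq ?_
        have : (k : ℝ) + (s * k * P + -α * k) = 0 := by linear_combination (k : ℝ) * hsP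
        rw [mul_assoc, ← qpow_add hq, this, qpow_zero, mul_one]
      · intro k hk
        rw [if_neg (by simpa using hk), ENNReal.zero_rpow_of_pos hP0]
        simp
    calc (M * N) ^ P ≤ _ := ENNReal.rpow_le_rpow (mul_le_mul_right hlow M) hP0.le
      _ ≤ _ := h1
      _ ≤ _ := mul_le_mul_right hup C
  have hMP0 : M ^ P ≠ 0 := (ENNReal.rpow_pos (pos_iff_ne_zero.2 hM0) ENNReal.ofReal_ne_top).ne'
  have hMPt : M ^ P ≠ ∞ := ENNReal.rpow_ne_top_of_nonneg hP0.le ENNReal.ofReal_ne_top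
  -- Any N beyond this threshold violates `key`; P > 1 is what makes N^P outgrow N.
  have hK : (C * 2 / M ^ P) ^ (P - 1)⁻¹ ≠ ∞ :=
    ENNReal.rpow_ne_top_of_nonneg (inv_nonneg.2 (by linarith))
      (ENNReal.div_ne_top (ENNReal.mul_ne_top hC (by norm_num)) hMP0)
  obtain ⟨N, hN⟩ := ENNReal.exists_nat_gt hK
  have hN0 : (N : ℝ≥0∞) ≠ 0 := (zero_le.trans_lt hN).ne'
  have hNt : (N : ℝ≥0∞) ≠ ∞ := ENNReal.natCast_ne_top N
  rw [ENNReal.rpow_inv_lt_iff (by linarith), ENNReal.div_lt_iff (Or.inl hMP0) (Or.inl hMPt)] at hN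
  have h1 := key N
  rw [ENNReal.mul_rpow_of_nonneg _ _ hP0.le, ← mul_assoc] at h1
  have h2 : (N : ℝ≥0∞) ^ P = (N : ℝ≥0∞) ^ (P - 1) * N := by
    conv_rhs => rw [← ENNReal.rpow_one (N : ℝ≥0∞), ← ENNReal.rpow_mul, one_mul]
    rw [← ENNReal.rpow_add _ _ hN0 hNt, sub_add_cancel]
  rw [h2, ← mul_assoc, ENNReal.mul_le_mul_iff_left hN0 hNt, mul_comm (M ^ P)] at h1
  exact absurd hN (not_lt.2 h1)

theorem lt_of_extension_of_eq_one [hG : IsHomogeneousTree G q] {p : ℝ≥0∞} [Fact (1 ≤ p)]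
    (hp : p ≠ ∞) (hp1 : p.toReal = 1) {α β : ℝ} (hα : 1 < α) (hβ : 1 < β)
    (T : Lp ℂ p (mu G q o α) →L[ℂ] Lp ℂ p (mu G q o α))
    (hT : ∀ (f : V → ℂ) (hf : MemLp f p (mu G q o α)), MemLp f 2 (mu G q o β) →
      ∀ z, T (hf.toLp f) z = kernelOperator G q o α β f z) : α < β := by
  classical
  by_contra! hle
  have hq := hG.two_le
  have hTr := hG.isTree
  obtain ⟨C, hC, hb⟩ := exists_bound_of_extension hp hα hβ T hT
  have hr := rpow_neg_pos hq β
  have hB := profileNormSq_pos hq hr (mul_rpow_neg_lt_one hq hβ)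
  set B := profileNormSq q ((q : ℝ) ^ (-β)) with hBdef
  -- On the sphere of radius k the sibling difference of the kernel is at least B⁻¹ q^(β(k-1)),
  -- which is c q^(βk).
  set c : ℝ≥0∞ := ENNReal.ofReal B⁻¹ * qpow q (-β) with hc
  have hc0 : c ≠ 0 := mul_ne_zero (ENNReal.ofReal_pos.2 (inv_pos.2 hB)).ne' (qpow_ne_zero hq _)
  have key : ∀ n : ℕ, n * c ≤ C := by
    intro n
    obtain ⟨x, hx⟩ : (descendants G o n o).Nonempty :=
      Finset.card_pos.1 ((pow_pos (by omega : 0 < q) n).trans_le (le_card_descendants q n o))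
    have hxn : G.dist o x = n := by
      have := ((mem_descendants hTr).1 hx).1
      rwa [SimpleGraph.dist_self, zero_add] at this
    have h := hb (Pi.single x 1) 1 fun y => by
      by_cases h : y = x
      · subst h; simp
      · simp [Pi.single_eq_of_ne h]
    rw [hp1] at h
    simp only [ENNReal.rpow_one] at h
    have hR : ∑' y, ‖(Pi.single x 1 : V → ℂ) y‖ₑ * qpow q (-α * G.dist o y) = qpow q (-α * n) := by
      rw [tsum_eq_single x fun y hy => by simp [Pi.single_eq_of_ne hy], Pi.single_eq_same, hxn]
      simp
    have hL : ∀ z, ‖kernelOperator G q o α β (Pi.single x 1) z‖ₑ =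
        qpow q (-β * n) * ‖(explicitKernel G q o ((q : ℝ) ^ (-β)) x z : ℂ)‖ₑ := by
      intro z
      rw [kernelOperator_eq hβ, tsum_eq_single x fun y hy => by simp [Pi.single_eq_of_ne hy],
        Pi.single_eq_same, mul_one, explicitKernel_comm hβ, enorm_mul, hxn]
      congr 1
      rw [← ofReal_norm, norm_pow, Complex.norm_real, Real.norm_of_nonneg hr.le,
        ← rpow_neg_mul_natCast, qpow]
    have hlow : n * (c * qpow q ((β - α) * n)) ≤
        ∑' z, ‖(explicitKernel G q o ((q : ℝ) ^ (-β)) x z : ℂ)‖ₑ * qpow q (-α * G.dist o z) := by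
      have hsec := tsum_sector_ennreal (o := o) hTr o fun z =>
        ‖(explicitKernel G q o ((q : ℝ) ^ (-β)) x z : ℂ)‖ₑ * qpow q (-α * G.dist o z)
      rw [sector_root hTr, Set.indicator_univ] at hsec
      have hcst : n * (c * qpow q ((β - α) * n)) =
          ∑ k ∈ Finset.Ioc 0 n, c * qpow q ((β - α) * n) := by simp
      rw [hsec, hcst]
      refine le_trans (Finset.sum_le_sum fun k hk => ?_) (ENNReal.sum_le_tsum (Finset.Ioc 0 n))
      obtain ⟨hk0, hkn⟩ := Finset.mem_Ioc.1 hk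
      have hi : n - k < G.dist o x := by omega
      set y := (parent G o)^[n - k] x with hy
      have hyo : y ≠ o := iterate_parent_ne_root hTr hi
      obtain ⟨s, hso, hys, hpar⟩ := exists_sibling (G := G) (q := q) (o := o) y
      have hdy : G.dist o y = k := by rw [hy, dist_iterate_parent hTr]; omega
      have hds : G.dist o s = k := by
        rw [← dist_parent_add_one hTr hso, ← hpar, dist_parent_add_one hTr hyo, hdy]
      have hmem : ∀ t, G.dist o t = k → t ∈ descendants G o k o := fun t ht =>
        (mem_descendants hTr).2 ⟨by rw [ht, SimpleGraph.dist_self, zero_add],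
          by rw [sector_root hTr]; trivial⟩
      have hsub : ({y, s} : Finset V) ⊆ descendants G o k o := by
        intro t ht
        rcases Finset.mem_insert.1 ht with rfl | ht
        · exact hmem _ hdy
        · rw [Finset.mem_singleton.1 ht]; exact hmem _ hds
      -- Keeping only the ancestor and its sibling suffices: the two absolute values add up to at
      -- least the difference.
      refine le_trans ?_ (Finset.sum_le_sum_of_subset hsub)
      rw [Finset.sum_pair hys, hdy, hds, ← add_mul]
      have hdiff := explicitKernel_sub_sibling (q := q) (r := (q : ℝ) ^ (-β)) hTr hi hso hys hpar
      have hnorm : ENNReal.ofReal B⁻¹ * qpow q (β * (k - 1)) ≤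
          ‖(explicitKernel G q o ((q : ℝ) ^ (-β)) x y : ℂ)‖ₑ +
            ‖(explicitKernel G q o ((q : ℝ) ^ (-β)) x s : ℂ)‖ₑ := by
        refine le_trans ?_ (enorm_sub_le (E := ℂ))
        rw [← Complex.ofReal_sub, hdiff, hds, ← ofReal_norm, Complex.norm_real, qpow,
          ← ENNReal.ofReal_mul (by positivity)]
        refine ENNReal.ofReal_le_ofReal (le_trans ?_ (le_abs_self _))
        refine mul_le_mul_of_nonneg_left ?_ (by positivity)
        have hpw : (((q : ℝ) ^ (-β)) ^ (k - 1))⁻¹ = (q : ℝ) ^ (β * ((k : ℝ) - 1)) := by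
          rw [← rpow_neg_mul_natCast, ← Real.rpow_neg (Nat.cast_nonneg q), Nat.cast_sub hk0]
          congr 1
          push_cast
          ring
        rw [hpw]
        exact le_mul_of_one_le_right (by positivity) (one_le_geomCoef_succ q _)
      refine le_trans ?_ (mul_le_mul_left hnorm _)
      rw [hc, mul_assoc, mul_assoc, ← qpow_add hq, ← qpow_add hq]
      refine mul_le_mul_right (qpow_mono hq ?_) _
      -- This is where β ≤ α enters: each of the n spheres contributes at least as much as the bound
      -- for k = n.
      have : (0 : ℝ) ≤ (α - β) * (n - k) :=
        mul_nonneg (by linarith) (sub_nonneg.2 (by exact_mod_cast hkn))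
      linarith
    rw [hR] at h
    simp only [hL, mul_assoc] at h
    rw [ENNReal.tsum_mul_left] at h
    have h2 := (mul_le_mul_right hlow (qpow q (-β * n))).trans h
    have h3 : qpow q (-β * n) * (n * (c * qpow q ((β - α) * n))) = n * c * qpow q (-α * n) := by
      have : qpow q (-α * n) = qpow q (-β * n) * qpow q ((β - α) * n) := by
        rw [← qpow_add hq]
        congr 1
        ring
      rw [this]
      ring
    rw [h3] at h2
    exact (ENNReal.mul_le_mul_iff_left (qpow_ne_zero hq _) (qpow_ne_top q _)).1 h2
  obtain ⟨n, hn⟩ := ENNReal.exists_nat_gt (ENNReal.div_ne_top hC hc0)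
  have hct : c ≠ ∞ := ENNReal.mul_ne_top ENNReal.ofReal_ne_top (qpow_ne_top q _)
  rw [ENNReal.div_lt_iff (Or.inl hc0) (Or.inl hct)] at hn
  exact absurd hn (not_lt.2 (key n))

theorem lt_of_extension [hG : IsHomogeneousTree G q] {p : ℝ≥0∞} [Fact (1 ≤ p)]
    (hp : p ≠ ∞) {α β : ℝ} (hα : 1 < α) (hβ : 1 < β)
    (T : Lp ℂ p (mu G q o α) →L[ℂ] Lp ℂ p (mu G q o α))
    (hT : ∀ (f : V → ℂ) (hf : MemLp f p (mu G q o α)), MemLp f 2 (mu G q o β) →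
      ∀ z, T (hf.toLp f) z = kernelOperator G q o α β f z) :
    α - 1 < p.toReal * (β - 1) := by
  have hpr : 1 ≤ p.toReal := by
    rw [← ENNReal.toReal_one]
    exact ENNReal.toReal_mono hp Fact.out
  rcases hpr.eq_or_lt with h | h
  · rw [← h, one_mul]
    linarith [lt_of_extension_of_eq_one hp h.symm hα hβ T hT]
  · exact lt_of_extension_of_one_lt hp h hα hβ T hT

end Rooted

end HarmonicBergman

theorem mainTheorem3 {V : Type*} [MeasurableSpace V] [DiscreteMeasurableSpace V]
    (G : SimpleGraph V) [G.LocallyFinite] (q : ℕ) [HarmonicBergman.IsHomogeneousTree G q] (o : V)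
    (p : ℝ≥0∞) [Fact (1 ≤ p)] (hp : p ≠ ∞) (α β : ℝ) (hα : 1 < α) (hβ : 1 < β) :
    -- the operator `𝒦_β^α`, defined on `L^p_α ∩ L^2_β`, extends boundedly from `L^p_α` to `𝒜^p_α`
    ((∃ T : Lp ℂ p (HarmonicBergman.mu G q o α) →L[ℂ] HarmonicBergman.bergman G q o p α,
        ∀ (f : V → ℂ) (hf : MemLp f p (HarmonicBergman.mu G q o α)),
          MemLp f 2 (HarmonicBergman.mu G q o β) →
          ∀ z, (T (hf.toLp f) : Lp ℂ p (HarmonicBergman.mu G q o α)) z =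
            HarmonicBergman.kernelOperator G q o α β f z) ↔
      p.toReal * (β - 1) > α - 1) ∧
    -- the Bergman projector `P_α`, restricted to `L^p_α ∩ L^2_α`, extends boundedly to `L^p_α`
    ((∃ T : Lp ℂ p (HarmonicBergman.mu G q o α) →L[ℂ] Lp ℂ p (HarmonicBergman.mu G q o α),
        ∀ (f : V → ℂ) (hf : MemLp f p (HarmonicBergman.mu G q o α))
          (hf₂ : MemLp f 2 (HarmonicBergman.mu G q o α)),
          ∀ z, T (hf.toLp f) z =
            (HarmonicBergman.projector G q o α (hf₂.toLp f) :
              Lp ℂ 2 (HarmonicBergman.mu G q o α)) z) ↔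
      1 < p) := by
  -- The criterion at β = α, after cancelling α - 1 > 0.
  have hp1 : 1 < p ↔ α - 1 < p.toReal * (α - 1) := by
    rw [lt_mul_iff_one_lt_left (sub_pos.2 hα), ← ENNReal.toReal_one,
      ENNReal.toReal_lt_toReal ENNReal.one_ne_top hp]
  refine ⟨⟨?_, fun h => ?_⟩, ⟨?_, fun h => ?_⟩⟩
  · rintro ⟨T, hT⟩
    exact HarmonicBergman.lt_of_extension hp hα hβ
      ((HarmonicBergman.bergman G q o p α).subtypeL.comp T) hT
  · obtain ⟨T, hT⟩ := HarmonicBergman.exists_extension_of_lt (G := G) (q := q) (o := o) hp hα hβ h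
    exact ⟨T, fun f hf _ => hT f hf⟩
  · rintro ⟨T, hT⟩
    refine hp1.2 (HarmonicBergman.lt_of_extension hp hα hα T fun f hf hf₂ z => ?_)
    rw [hT f hf hf₂, HarmonicBergman.projector_eq_kernelOperator hα]
  · obtain ⟨T, hT⟩ :=
      HarmonicBergman.exists_extension_of_lt (G := G) (q := q) (o := o) hp hα hα (hp1.1 h)
    refine ⟨(HarmonicBergman.bergman G q o p α).subtypeL.comp T, fun f hf hf₂ z => ?_⟩
    rw [HarmonicBergman.projector_eq_kernelOperator hα]
    exact hT f hf z
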